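/- **Problem.** Let $f\colon\mathbb R^n\to\mathbb R$, $g\colon\mathbb R^n\to\mathbb R^\ell$, $h\colon\mathbb R^n\to\mathbb R^m$, $G,H\colon\mathbb R^n\to\mathbb R^p$ be twice continuously differentiable, and consider $$\min_x f(x)\quad\text{s.t.}\quad g(x)\le 0,\ h(x)=0,\ G(x)\ge 0,\ H(x)\ge 0,\ G(x)^\top H(x)=0 .$$ Let $\mathcal L(z)=f(x)+\lambda^\top g(x)+\eta^\top h(x)+\mu^\top G(x)+\nu^\top H(x)$ for $z=(x,\lambda,\eta,\mu,\nu)\in\mathbb R^{n+\ell+m+2p}$ (all norms are Euclidean). For feasible $x$ put $I^g=\{i: g_i(x)=0\}$, $I^{+0}=\{i: G_i(x)>0=H_i(x)\}$, $I^{0+}=\{i: G_i(x)=0<H_i(x)\}$, $I^{00}=\{i: G_i(x)=H_i(x)=0\}$. * $z$ is a *primal-dual M-stationary tuple* if $x$ is feasible, $\nabla_x\mathcal L(z)=0$, $\lambda_i\ge0$ for $i\in I^g$, $\lambda_i=0$ for $i\notin I^g$, $\mu_i=0$ on $I^{+0}$, $\nu_i=0$ on $I^{0+}$, and $\mu_i\nu_i=0$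 or ($\mu_i<0$ and $\nu_i<0$) for each $i\in I^{00}$. * *MPCC-LICQ* holds at $x$ if the gradients at $x$ of $g_i$ $(i\in I^g)$, of all $h_i$, of $G_i$ $(i\in I^{0+}\cup I^{00})$ and of $H_i$ $(i\in I^{+0}\cup I^{00})$ are linearly independent. * *MPCC-SSOC* holds at an M-stationary tuple $z$ if $v^\top\nabla^2_{xx}\mathcal L(z)v>0$ for all $v\neq0$ with $\nabla g_i(x)^\top v=0$ ($i\in I^g$, $\lambda_i>0$), $h'(x)v=0$, $\nabla G_i(x)^\top v=0$ ($i\in I^{0+}$, or $i\in I^{00}$ with $\mu_i\ne0$), $\nabla H_i(x)^\top v=0$ ($i\in I^{+0}$, or $i\in I^{00}$ with $\nu_i\neq0$), and $(\nabla G_i(x)^\top v)(\nabla H_i(x)^\top v)=0$ ($i\in I^{00}$, $\mu_i=\nu_i=0$). **The nonsmooth system.** For $w=(a,b,\mu,\nu)\in\mathbb R^4$ let $$\varphi_1(w)=\min\bigl(\max(-a,|b|,|\mu|),\ \max(-b,|a|,|\nu|),\ \max(|a|,|b|,\mu,\nu)\bigr).$$ Its Newton derivative $D\varphi_1(w)\in\{\pm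 e_1^\top,\dots,\pm e_4^\top\}$ is obtained by the chain rule from the conventions that $D\min$ and $D\max$ select the first argument attaining the minimum or maximum, and that $D|\cdot|(t)=1$ for $t\ge0$ and $-1$ for $t<0$. Let $\varphi_2(w)$ be $\min(|b|,|\nu|)$, $\min(|a|,|\mu|)$, $|b|$, $|a|$ if $D\varphi_1(w)$ is $\pm e_1^\top,\pm e_2^\top,\pm e_3^\top,\pm e_4^\top$, respectively, with $D\varphi_2$ formed by the same case distinction and the same conventions. Set $\varphi=(\varphi_1,\varphi_2)$ and $$F(z)=\bigl(\nabla_x\mathcal L(z),\ [\min(-g_i(x),\lambda_i)]_i,\ h(x),\ [\varphi(G_i(x),H_i(x),\mu_i,\nu_i)]_i\bigr),$$ with Newton derivative $DF(z)$ given by the chain rule and the same conventions. **Merit function.** With $\pi(a,b)=\sqrt{a^2+b^2}-a-b$ let $\theta(a,b,\mu,\nu)=\bigl(|\pi(a,b)|,\ \pi(|a|,|\mu|),\ \pi(|b|,|\nu|),\ \theta_4\bigr)$, where $\theta_4=0$ if $\mu,\nu\le0$ and $\theta_4=\pi(|\mu|,|\nu|)$ otherwise. Put $$F_{\mathrm{FB}}(z)=\bigl(\nabla_x\mathcal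 L(z),\ [\pi(-g_i(x),\lambda_i)]_i,\ h(x),\ [\theta(G_i(x),H_i(x),\mu_i,\nu_i)]_i\bigr),\qquad \Phi_{\mathrm{FB}}(z)=\tfrac12\|F_{\mathrm{FB}}(z)\|^2 .$$ **Algorithm.** Let $q,\rho,\sigma,\beta\in(0,1)$, $\tau\in[0,1)$ and a starting point $z_0$ be given. As long as $\|F(z_k)\|>\tau$: try to solve $DF(z_k)d_k=-F(z_k)$ (if there is exactly one solution, it is $d_k$; if there is none, $d_k$ is not well defined; if there are several, $d_k$ may be any of them or be declared not well defined). If $d_k$ is well defined and satisfies the ratio test $\Phi_{\mathrm{FB}}(z_k+d_k)/\Phi_{\mathrm{FB}}(z_k)\le q$, set $z_{k+1}=z_k+d_k$. Otherwise, if $d_k$ is not well defined or $\nabla\Phi_{\mathrm{FB}}(z_k)^\top d_k>-\rho\|d_k\|\|\nabla\Phi_{\mathrm{FB}}(z_k)\|$, replace $d_k$ by $-\nabla\Phi_{\mathrm{FB}}(z_k)$; then set $z_{k+1}=z_k+\beta^{i_k}d_k$, where $i_k\in\mathbb N_0$ is the smallest number with $\Phi_{\mathrm{FB}}(z_k+\beta^{i_k}d_k)\le\Phi_{\mathrm{FB}}(z_k)+\sigma\beta^{i_k}\nabla\Phi_{\mathrm{FB}}(z_k)^\top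 d_k$. **Theorem.** The function $\Phi_{\mathrm{FB}}$ is continuously differentiable. Let $(z_k)_{k\in\mathbb N}$ be an infinite sequence generated by the algorithm. 1. If the ratio test is satisfied (by a well-defined $d_k$) for infinitely many $k$, then $\Phi_{\mathrm{FB}}(z_k)\to0$, and every accumulation point of $(z_k)$ is a primal-dual M-stationary tuple. 2. Every accumulation point $\bar z$ of $(z_k)$ is a stationary point of $\Phi_{\mathrm{FB}}$, i.e. $\nabla\Phi_{\mathrm{FB}}(\bar z)=0$. 3. If an accumulation point $\bar z=(\bar x,\bar\lambda,\bar\eta,\bar\mu,\bar\nu)$ of $(z_k)$ is a primal-dual M-stationary tuple such that MPCC-LICQ holds at $\bar x$ and MPCC-SSOC holds at $\bar x$ with respect to $(\bar\lambda,\bar\eta,\bar\mu,\bar\nu)$, then the entire sequence converges to $\bar z$ superlinearly: $z_k\to\bar z$ and $\|z_{k+1}-\bar z\|=o(\|z_k-\bar z\|)$. If, additionally, the second-order derivatives of $f,g,h,G,H$ are locally Lipschitz continuous, the convergence is quadratic: $\|z_{k+1}-\bar z\|=O(\|z_k-\bar z\|^2)$. -/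

import Mathlib

noncomputable section

/-! ### The functions `φ₁`, `φ₂` and their Newton derivatives -/

/-- A function on `ℝ⁴` evaluated at a point, together with its Newton derivative (a row vector)
at the same point.  The operations below propagate the derivative by the chain rule. -/
abbrev NewtonPair : Type := ℝ × (Fin 4 → ℝ)

namespace NewtonPair

/-- The coordinate function `w ↦ w i`, with derivative `e_iᵀ`. -/
def coord (w : Fin 4 → ℝ) (i : Fin 4) : NewtonPair := (w i, Pi.single i 1)

def neg (u : NewtonPair) : NewtonPair := (-u.1, -u.2)

/-- Absolute value; the Newton derivative of `|·|` is `1` on `[0, ∞)` and `-1` on `(-∞, 0)`. -/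
def abs (u : NewtonPair) : NewtonPair := if 0 ≤ u.1 then u else neg u

/-- Minimum; in case of a tie the derivative of the first argument is taken. -/
def min (u v : NewtonPair) : NewtonPair := if u.1 ≤ v.1 then u else v

/-- Maximum; in case of a tie the derivative of the first argument is taken. -/
def max (u v : NewtonPair) : NewtonPair := if v.1 ≤ u.1 then u else v

theorem abs_fst (u : NewtonPair) : (abs u).1 = |u.1| := by
  unfold abs neg
  split_ifs with h
  · exact (abs_of_nonneg h).symm
  · exact (abs_of_neg (not_le.mp h)).symm

theorem min_fst (u v : NewtonPair) : (min u v).1 = Min.min u.1 v.1 := by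
  unfold min
  split_ifs with h
  · exact (min_eq_left h).symm
  · exact (min_eq_right (not_le.mp h).le).symm

theorem max_fst (u v : NewtonPair) : (max u v).1 = Max.max u.1 v.1 := by
  unfold max
  split_ifs with h
  · exact (max_eq_left h).symm
  · exact (max_eq_right (not_le.mp h).le).symm

/-- `ψ₁(a,b,μ,ν) = max(-a, |b|, |μ|)`. -/
def psi1 (w : Fin 4 → ℝ) : NewtonPair :=
  max (neg (coord w 0)) (max (abs (coord w 1)) (abs (coord w 2)))

/-- `ψ₂(a,b,μ,ν) = max(-b, |a|, |ν|)`. -/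
def psi2 (w : Fin 4 → ℝ) : NewtonPair :=
  max (neg (coord w 1)) (max (abs (coord w 0)) (abs (coord w 3)))

/-- `ψ₃(a,b,μ,ν) = max(|a|, |b|, μ, ν)`. -/
def psi3 (w : Fin 4 → ℝ) : NewtonPair :=
  max (abs (coord w 0)) (max (abs (coord w 1)) (max (coord w 2) (coord w 3)))

/-- `φ₁ = min(ψ₁, ψ₂, ψ₃)`. -/
def phi1 (w : Fin 4 → ℝ) : NewtonPair := min (psi1 w) (min (psi2 w) (psi3 w))

open Classical in
/-- `φ₂`, by cases on the Newton derivative of `φ₁`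
(which is always `± e_iᵀ` for one of the four unit vectors). -/
def phi2 (w : Fin 4 → ℝ) : NewtonPair :=
  if (phi1 w).2 = Pi.single 0 1 ∨ (phi1 w).2 = -Pi.single 0 1 then
    min (abs (coord w 1)) (abs (coord w 3))
  else if (phi1 w).2 = Pi.single 1 1 ∨ (phi1 w).2 = -Pi.single 1 1 then
    min (abs (coord w 0)) (abs (coord w 2))
  else if (phi1 w).2 = Pi.single 2 1 ∨ (phi1 w).2 = -Pi.single 2 1 then
    abs (coord w 1)
  else
    abs (coord w 0)

/-- The value component of `phi1` is the explicit min-max expression. -/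
theorem phi1_fst (w : Fin 4 → ℝ) :
    (phi1 w).1 =
      Min.min (Max.max (-w 0) (Max.max |w 1| |w 2|))
        (Min.min (Max.max (-w 1) (Max.max |w 0| |w 3|))
          (Max.max |w 0| (Max.max |w 1| (Max.max (w 2) (w 3))))) := by
  simp only [phi1, psi1, psi2, psi3, min_fst, max_fst, abs_fst, neg, coord]

end NewtonPair

/-! ### The Fischer-Burmeister function and `θ_FB` -/

/-- `π_FB(a,b) = √(a² + b²) - a - b`. -/
def piFB (a b : ℝ) : ℝ := Real.sqrt (a ^ 2 + b ^ 2) - a - b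

open Classical in
/-- The four components of `θ_FB(a,b,μ,ν)`. -/
def thetaFB (w : Fin 4 → ℝ) : Fin 4 → ℝ :=
  ![|piFB (w 0) (w 1)|,
    piFB |w 0| |w 2|,
    piFB |w 1| |w 3|,
    if w 2 ≤ 0 ∧ w 3 ≤ 0 then 0 else piFB |w 2| |w 3|]

/-! ### Primal-dual variables -/

/-- Indices of the primal-dual variable `z = (x, λ, η, μ, ν)`. -/
abbrev PDIndex (n l m p : ℕ) : Type := Fin n ⊕ Fin l ⊕ Fin m ⊕ Fin p ⊕ Fin p

/-- The space `ℝⁿ × ℝˡ × ℝᵐ × ℝᵖ × ℝᵖ` with the Euclidean norm. -/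
abbrev PDSpace (n l m p : ℕ) : Type := EuclideanSpace ℝ (PDIndex n l m p)

namespace PDSpace

variable {n l m p : ℕ}

/-- The `x`-block. -/
def x (z : PDSpace n l m p) : EuclideanSpace ℝ (Fin n) := WithLp.toLp 2 fun i => z (Sum.inl i)

/-- The `λ`-block. -/
def lam (z : PDSpace n l m p) : Fin l → ℝ := fun i => z (Sum.inr (Sum.inl i))

/-- The `η`-block. -/
def eta (z : PDSpace n l m p) : Fin m → ℝ := fun i => z (Sum.inr (Sum.inr (Sum.inl i)))

/-- The `μ`-block. -/
def mu (z : PDSpace n l m p) : Fin p → ℝ :=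
  fun i => z (Sum.inr (Sum.inr (Sum.inr (Sum.inl i))))

/-- The `ν`-block. -/
def nu (z : PDSpace n l m p) : Fin p → ℝ :=
  fun i => z (Sum.inr (Sum.inr (Sum.inr (Sum.inr i))))

end PDSpace

/-! ### Mathematical programs with complementarity constraints -/

/-- The data of the problem: minimize `f x` subject to `g x ≤ 0`, `h x = 0`,
`0 ≤ G x ⊥ H x ≥ 0`; the constraint mappings are given by their components. -/
structure MPCC (n l m p : ℕ) where
  f : EuclideanSpace ℝ (Fin n) → ℝ
  g : Fin l → EuclideanSpace ℝ (Fin n) → ℝ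
  h : Fin m → EuclideanSpace ℝ (Fin n) → ℝ
  G : Fin p → EuclideanSpace ℝ (Fin n) → ℝ
  H : Fin p → EuclideanSpace ℝ (Fin n) → ℝ

namespace MPCC

variable {n l m p : ℕ} (P : MPCC n l m p)

/-- All data functions are twice continuously differentiable. -/
structure IsC2 : Prop where
  f : ContDiff ℝ 2 P.f
  g : ∀ i, ContDiff ℝ 2 (P.g i)
  h : ∀ i, ContDiff ℝ 2 (P.h i)
  G : ∀ i, ContDiff ℝ 2 (P.G i)
  H : ∀ i, ContDiff ℝ 2 (P.H i)

/-- The second derivatives of all data functions are locally Lipschitz continuous. -/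
structure HasLocallyLipschitzSecondDerivatives : Prop where
  f : LocallyLipschitz (fderiv ℝ (fderiv ℝ P.f))
  g : ∀ i, LocallyLipschitz (fderiv ℝ (fderiv ℝ (P.g i)))
  h : ∀ i, LocallyLipschitz (fderiv ℝ (fderiv ℝ (P.h i)))
  G : ∀ i, LocallyLipschitz (fderiv ℝ (fderiv ℝ (P.G i)))
  H : ∀ i, LocallyLipschitz (fderiv ℝ (fderiv ℝ (P.H i)))

structure Feasible (x : EuclideanSpace ℝ (Fin n)) : Prop where
  g_nonpos : ∀ i, P.g i x ≤ 0
  h_eq_zero : ∀ i, P.h i x = 0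
  G_nonneg : ∀ i, 0 ≤ P.G i x
  H_nonneg : ∀ i, 0 ≤ P.H i x
  complementary : ∑ i, P.G i x * P.H i x = 0

/-- The MPCC-Lagrangian. -/
def lagrangian (x : EuclideanSpace ℝ (Fin n)) (lam : Fin l → ℝ) (eta : Fin m → ℝ)
    (mu nu : Fin p → ℝ) : ℝ :=
  P.f x + ∑ i, lam i * P.g i x + ∑ i, eta i * P.h i x + ∑ i, mu i * P.G i x
    + ∑ i, nu i * P.H i x

/-- The gradient `∇ₓL(z)` of the Lagrangian with respect to `x`. -/
def gradLagrangian (z : PDSpace n l m p) : EuclideanSpace ℝ (Fin n) :=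
  gradient (fun y => P.lagrangian y z.lam z.eta z.mu z.nu) z.x

/-- The Hessian `∇²ₓₓL(z)` of the Lagrangian with respect to `x`. -/
def hessLagrangian (z : PDSpace n l m p) :
    EuclideanSpace ℝ (Fin n) →L[ℝ] EuclideanSpace ℝ (Fin n) :=
  fderiv ℝ (gradient (fun y => P.lagrangian y z.lam z.eta z.mu z.nu)) z.x

/-! Index sets -/

/-- `I^g(x)`. -/
def activeG (x : EuclideanSpace ℝ (Fin n)) : Set (Fin l) := {i | P.g i x = 0}

/-- `I^{+0}(x)`. -/
def indexPosZero (x : EuclideanSpace ℝ (Fin n)) : Set (Fin p) := {i | 0 < P.G i x ∧ P.H i x = 0}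

/-- `I^{0+}(x)`. -/
def indexZeroPos (x : EuclideanSpace ℝ (Fin n)) : Set (Fin p) := {i | P.G i x = 0 ∧ 0 < P.H i x}

/-- `I^{00}(x)`. -/
def biactive (x : EuclideanSpace ℝ (Fin n)) : Set (Fin p) := {i | P.G i x = 0 ∧ P.H i x = 0}

/-- `z = (x, λ, η, μ, ν)` is a primal-dual M-stationary tuple: `x` is feasible and
`(λ, η, μ, ν)` solves the system of M-stationarity at `x`. -/
structure IsMStationaryTuple (z : PDSpace n l m p) : Prop where
  feasible : P.Feasible z.x
  grad_eq_zero : P.gradLagrangian z = 0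
  lam_nonneg : ∀ i ∈ P.activeG z.x, 0 ≤ z.lam i
  lam_eq_zero : ∀ i ∉ P.activeG z.x, z.lam i = 0
  mu_eq_zero : ∀ i ∈ P.indexPosZero z.x, z.mu i = 0
  nu_eq_zero : ∀ i ∈ P.indexZeroPos z.x, z.nu i = 0
  biactive : ∀ i ∈ P.biactive z.x, z.mu i * z.nu i = 0 ∨ (z.mu i < 0 ∧ z.nu i < 0)

/-- MPCC-LICQ at `x`: the gradients of the `g_i` (`i ∈ I^g`), of all `h_i`,
of the `G_i` (`i ∈ I^{0+} ∪ I^{00}`) and of the `H_i` (`i ∈ I^{+0} ∪ I^{00}`) form a linearly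
independent family. -/
def LICQ (x : EuclideanSpace ℝ (Fin n)) : Prop :=
  LinearIndependent ℝ
    (Sum.elim (fun i : P.activeG x => gradient (P.g i) x)
      (Sum.elim (fun i : Fin m => gradient (P.h i) x)
        (Sum.elim
          (fun i : (P.indexZeroPos x ∪ P.biactive x : Set (Fin p)) => gradient (P.G i) x)
          (fun i : (P.indexPosZero x ∪ P.biactive x : Set (Fin p)) => gradient (P.H i) x))))

/-- The set `S(x, λ, μ, ν)` of the strong second-order condition. -/
structure InSSOCSet (z : PDSpace n l m p) (v : EuclideanSpace ℝ (Fin n)) : Prop where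
  g : ∀ i ∈ P.activeG z.x, 0 < z.lam i → inner ℝ (gradient (P.g i) z.x) v = 0
  h : ∀ i, inner ℝ (gradient (P.h i) z.x) v = 0
  G : ∀ i ∈ P.indexZeroPos z.x ∪ {j ∈ P.biactive z.x | z.mu j ≠ 0},
    inner ℝ (gradient (P.G i) z.x) v = 0
  H : ∀ i ∈ P.indexPosZero z.x ∪ {j ∈ P.biactive z.x | z.nu j ≠ 0},
    inner ℝ (gradient (P.H i) z.x) v = 0
  GH : ∀ i ∈ P.biactive z.x, z.mu i = 0 → z.nu i = 0 →
    inner ℝ (gradient (P.G i) z.x) v * inner ℝ (gradient (P.H i) z.x) v = 0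

/-- MPCC-SSOC at `x` with respect to the multipliers `(λ, η, μ, ν)`. -/
def SSOC (z : PDSpace n l m p) : Prop :=
  ∀ v : EuclideanSpace ℝ (Fin n), P.InSSOCSet z v → v ≠ 0 → 0 < inner ℝ v (P.hessLagrangian z v)

/-! The nonsmooth system `F(z) = 0` and the Newton derivative of `F` -/

/-- `w_i = (G_i(x), H_i(x), μ_i, ν_i)`. -/
def compl (z : PDSpace n l m p) (i : Fin p) : Fin 4 → ℝ :=
  ![P.G i z.x, P.H i z.x, z.mu i, z.nu i]

/-- The derivative of `z ↦ w_i` at `z` in direction `d`. -/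
def complDeriv (z d : PDSpace n l m p) (i : Fin p) : Fin 4 → ℝ :=
  ![inner ℝ (gradient (P.G i) z.x) d.x, inner ℝ (gradient (P.H i) z.x) d.x, d.mu i, d.nu i]

/-- The map `F`; the values `φ(w_i) = (φ₁(w_i), φ₂(w_i))` are stored in the last two blocks. -/
def F (z : PDSpace n l m p) : PDSpace n l m p :=
  WithLp.toLp 2
    (Sum.elim (fun i => P.gradLagrangian z i)
      (Sum.elim (fun i => min (-P.g i z.x) (z.lam i))
        (Sum.elim (fun i => P.h i z.x)
          (Sum.elim (fun i => (NewtonPair.phi1 (P.compl z i)).1)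
            (fun i => (NewtonPair.phi2 (P.compl z i)).1)))))

open Classical in
/-- The Newton derivative `DF(z)` of `F`, as a linear map. -/
def DF (z : PDSpace n l m p) : PDSpace n l m p →ₗ[ℝ] PDSpace n l m p where
  toFun d := WithLp.toLp 2
    (Sum.elim
      (fun i => (P.hessLagrangian z d.x
        + ∑ j, d.lam j • gradient (P.g j) z.x + ∑ j, d.eta j • gradient (P.h j) z.x
        + ∑ j, d.mu j • gradient (P.G j) z.x + ∑ j, d.nu j • gradient (P.H j) z.x) i)
      (Sum.elim
        (fun i => if -P.g i z.x ≤ z.lam i then -inner ℝ (gradient (P.g i) z.x) d.x else d.lam i)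
        (Sum.elim (fun i => inner ℝ (gradient (P.h i) z.x) d.x)
          (Sum.elim
            (fun i => dotProduct (NewtonPair.phi1 (P.compl z i)).2 (P.complDeriv z d i))
            (fun i => dotProduct (NewtonPair.phi2 (P.compl z i)).2 (P.complDeriv z d i))))))
  map_add' d e := by
    have hx : (d + e).x = d.x + e.x := rfl
    have hl : (d + e).lam = d.lam + e.lam := rfl
    have he : (d + e).eta = d.eta + e.eta := rfl
    have hm : (d + e).mu = d.mu + e.mu := rfl
    have hn : (d + e).nu = d.nu + e.nu := rfl
    have hc : ∀ i, P.complDeriv z (d + e) i = P.complDeriv z d i + P.complDeriv z e i := by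
      intro i
      ext j
      fin_cases j <;> simp [complDeriv, hx, hm, hn, inner_add_right]
    ext i
    rcases i with i | i | i | i | i
    · simp only [hx, hl, he, hm, hn, map_add, Pi.add_apply, add_smul, Finset.sum_add_distrib,
        PiLp.add_apply, Sum.elim_inl]
      ring
    · by_cases hi : -P.g i z.x ≤ z.lam i
      · simp [hi, hx, inner_add_right]
        ring
      · simp [hi, hl]
    · simp [hx, inner_add_right]
    · simp [hc, dotProduct_add]
    · simp [hc, dotProduct_add]
  map_smul' c d := by
    have hx : (c • d).x = c • d.x := rfl
    have hl : (c • d).lam = c • d.lam := rfl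
    have he : (c • d).eta = c • d.eta := rfl
    have hm : (c • d).mu = c • d.mu := rfl
    have hn : (c • d).nu = c • d.nu := rfl
    have hc : ∀ i, P.complDeriv z (c • d) i = c • P.complDeriv z d i := by
      intro i
      ext j
      fin_cases j <;> simp [complDeriv, hx, hm, hn, inner_smul_right]
    ext i
    rcases i with i | i | i | i | i
    · simp only [hx, hl, he, hm, hn, map_smul, Pi.smul_apply, smul_eq_mul, mul_smul,
        ← Finset.smul_sum, PiLp.add_apply, PiLp.smul_apply, Sum.elim_inl, RingHom.id_apply]
      ring
    · by_cases hi : -P.g i z.x ≤ z.lam i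
      · simp [hi, hx, inner_smul_right]
      · simp [hi, hl]
    · simp [hx, inner_smul_right]
    · simp [hc, dotProduct_smul]
    · simp [hc, dotProduct_smul]

/-! The merit function -/

/-- The modified residual `F_FB`. -/
def FFB (z : PDSpace n l m p) : EuclideanSpace ℝ (Fin n ⊕ Fin l ⊕ Fin m ⊕ (Fin p × Fin 4)) :=
  WithLp.toLp 2
    (Sum.elim (fun i => P.gradLagrangian z i)
      (Sum.elim (fun i => piFB (-P.g i z.x) (z.lam i))
        (Sum.elim (fun i => P.h i z.x)
          (fun ij => thetaFB (P.compl z ij.1) ij.2))))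

/-- The merit function `Φ_FB(z) = ½ ‖F_FB(z)‖²`. -/
def merit (z : PDSpace n l m p) : ℝ := 1 / 2 * ‖P.FFB z‖ ^ 2

/-! The globalized semismooth Newton method -/

/-- `o` is an admissible outcome of the attempt to solve the Newton system `DF(z) d = -F(z)`:
either a solution `d`, or `none` (the direction is not well defined).  A uniquely solvable system
has to be solved, an unsolvable one cannot be; if there are several solutions, the attempt may
return any of them or `none`. -/
def IsNewtonOutcome (z : PDSpace n l m p) : Option (PDSpace n l m p) → Prop
  | some d => P.DF z d = -P.F z
  | none => ¬ ∃! d, P.DF z d = -P.F z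

/-- The Newton direction is well defined and passes the ratio test with parameter `q`. -/
def RatioTest (q : ℝ) (z : PDSpace n l m p) (o : Option (PDSpace n l m p)) : Prop :=
  ∃ d, o = some d ∧ P.merit (z + d) / P.merit z ≤ q

open Classical in
/-- The direction of the line search: the Newton direction if it is well defined and passes the
angle test with parameter `ρ`, and `-∇Φ_FB(z)` otherwise. -/
def searchDirection (ρ : ℝ) (z : PDSpace n l m p) : Option (PDSpace n l m p) → PDSpace n l m p
  | some d =>
    if inner ℝ (gradient P.merit z) d > -ρ * ‖d‖ * ‖gradient P.merit z‖ then
      -gradient P.merit z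
    else d
  | none => -gradient P.merit z

/-- `i` is the smallest `i ∈ ℕ₀` such that the step length `β^i` satisfies the Armijo condition
for `Φ_FB` at `z` along `d`. -/
def IsArmijoExponent (σ β : ℝ) (z d : PDSpace n l m p) (i : ℕ) : Prop :=
  IsLeast {j : ℕ | P.merit (z + β ^ j • d)
    ≤ P.merit z + σ * β ^ j * inner ℝ (gradient P.merit z) d} i

/-- One iteration of the globalized method, from `z` to `z'`. -/
def IsStep (q ρ σ β : ℝ) (z : PDSpace n l m p) (o : Option (PDSpace n l m p))
    (z' : PDSpace n l m p) : Prop :=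
  P.IsNewtonOutcome z o ∧
    ((P.RatioTest q z o ∧ ∃ d, o = some d ∧ z' = z + d) ∨
      (¬ P.RatioTest q z o ∧ ∃ i, P.IsArmijoExponent σ β z (P.searchDirection ρ z o) i ∧
        z' = z + β ^ i • P.searchDirection ρ z o))

/-- `z` is an infinite sequence of iterates generated by the globalized method (so that the
stopping test `‖F(z_k)‖ ≤ τ` is never satisfied), `o` being the sequence of outcomes of the
attempts to compute the Newton directions. -/
def IsRun (q τ ρ σ β : ℝ) (z : ℕ → PDSpace n l m p) (o : ℕ → Option (PDSpace n l m p)) : Prop :=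
  ∀ k, τ < ‖P.F (z k)‖ ∧ P.IsStep q ρ σ β (z k) (o k) (z (k + 1))

end MPCC

end

/-!
A globalized Newton method for the nonsmooth system `F(z) = 0` that encodes M-stationarity of a
mathematical program with complementarity constraints.

*Equivalence of the residuals.* The value `φ₁(w)` is the largest of the elementary residuals
`|min(a,b)|`, `min(|a|,|μ|)`, `min(|b|,|ν|)` and (unless `μ, ν ≤ 0`) `min(|μ|,|ν|)`
(`NewtonPair.residuals_le_phi1`, `NewtonPair.phi1_le_of_residuals_le`), and `|φ₂| ≤ φ₁`. Since the
Fischer-Burmeister function is equivalent to the minimum, `‖F‖` and `‖F_FB‖` are globally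
equivalent (`MPCC.exists_norm_equiv`), and the common zeros of `F` and `F_FB` are the M-stationary
tuples. In particular the merit function never vanishes at an iterate, so the quotient in the ratio
test is a genuine one.

*Smoothness of the merit function.* Each component of `F_FB` is smooth, or is obtained from a
Lipschitz function that is `C¹` off its zeros by an inner `C¹` map; the square of such a Lipschitz
function is `C¹` (`contDiff_sq_of_lipschitzWith`).

*Global convergence.* The merit values are nonincreasing, so infinitely many successful ratio tests
drive them to zero. In the other case all steps are eventually Armijo steps along directions
satisfying the angle condition. Near a nonstationary point these directions are bounded away from
zero, because `DF` is locally bounded and `‖F‖ ≥ c ‖F_FB‖`; so each such step decreases the merit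
function by a fixed amount (`exists_armijo_decrease`), which can happen only finitely often.

*Local convergence.* At each point, `F` and `DF` are the value and the derivative of one of finitely
many `C¹` maps (`MPCC.selF`). Those that occur near an M-stationary tuple `zbar` vanish at `zbar`
(`MPCC.eventually_isConsistent_sel`), and MPCC-LICQ with MPCC-SSOC makes their derivatives injective
there (`MPCC.eq_zero_of_fderiv_selF_eq_zero`). Hence near `zbar` the Newton derivatives are
uniformly invertible, and `F(z) - DF(z)(z - zbar)` is `o(‖z - zbar‖)`, or
`O(‖z - zbar‖²)` if the second derivatives are locally Lipschitz. The Newton step thus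
reduces the error superlinearly, whence it also passes the ratio test (`MPCC.eventually_newton_step`),
and a run that comes close to `zbar` once converges to it.
-/

noncomputable section

open Filter Topology Asymptotics

/-! ### The Fischer-Burmeister function -/

theorem piFB_comm (a b : ℝ) : piFB a b = piFB b a := by
  simp only [piFB, add_comm (a ^ 2)]; ring

/-- Together with `abs_min_le_piFB`, this says that `piFB` and `min` are equivalent as measures of
the violation of complementarity. -/
theorem abs_piFB_le (a b : ℝ) : |piFB a b| ≤ 4 * |min a b| := by
  wlog hab : a ≤ b generalizing a b
  · rw [piFB_comm, min_comm]; exact this b a (le_of_not_ge hab)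
  rw [min_eq_left hab, piFB]
  have h1 : √(a ^ 2 + b ^ 2) ≤ |a| + |b| := by
    rw [Real.sqrt_le_left (by positivity)]
    nlinarith [abs_nonneg a, abs_nonneg b, sq_abs a, sq_abs b]
  have h2 : |b| ≤ √(a ^ 2 + b ^ 2) := Real.abs_le_sqrt (by nlinarith [sq_nonneg a])
  rw [abs_le]
  rcases abs_cases a with ⟨h, h'⟩ | ⟨h, h'⟩ <;> rcases abs_cases b with ⟨k, k'⟩ | ⟨k, k'⟩ <;>
    constructor <;> linarith

theorem abs_min_le_piFB (a b : ℝ) : |min a b| ≤ 2 * |piFB a b| := by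
  wlog hab : a ≤ b generalizing a b
  · rw [piFB_comm, min_comm]; exact this b a (le_of_not_ge hab)
  rw [min_eq_left hab, piFB]
  rcases le_or_gt a 0 with ha | ha
  · have h2 : |b| ≤ √(a ^ 2 + b ^ 2) := Real.abs_le_sqrt (by nlinarith [sq_nonneg a])
    rw [abs_of_nonpos ha]
    have := le_abs_self (√(a ^ 2 + b ^ 2) - a - b)
    linarith [le_abs_self b]
  · have h1 : √(a ^ 2 + b ^ 2) ≤ a / 2 + b := by
      rw [Real.sqrt_le_left (by linarith)]
      nlinarith
    rw [abs_of_pos ha]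
    have := neg_abs_le (√(a ^ 2 + b ^ 2) - a - b)
    linarith

theorem abs_piFB_sub_le (a b c d : ℝ) :
    |piFB a b - piFB c d| ≤ 2 * (|a - c| + |b - d|) := by
  have key : ∀ a b : ℝ, √(a ^ 2 + b ^ 2) = ‖(⟨a, b⟩ : ℂ)‖ := fun a b => by
    rw [Complex.norm_def, Complex.normSq_mk]; ring_nf
  have h : |√(a ^ 2 + b ^ 2) - √(c ^ 2 + d ^ 2)| ≤ |a - c| + |b - d| := by
    rw [key, key]
    refine (abs_norm_sub_norm_le _ _).trans ((Complex.norm_le_abs_re_add_abs_im _).trans ?_)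
    simp
  have e : piFB a b - piFB c d
      = (√(a ^ 2 + b ^ 2) - √(c ^ 2 + d ^ 2)) - (a - c) - (b - d) := by
    unfold piFB; ring
  rw [e]
  have h1 := abs_sub ((√(a ^ 2 + b ^ 2) - √(c ^ 2 + d ^ 2)) - (a - c)) (b - d)
  have h2 := abs_sub (√(a ^ 2 + b ^ 2) - √(c ^ 2 + d ^ 2)) (a - c)
  linarith

theorem piFB_zero_left {b : ℝ} (hb : 0 ≤ b) : piFB 0 b = 0 := by
  simp [piFB, Real.sqrt_sq hb]

theorem piFB_zero_right {a : ℝ} (ha : 0 ≤ a) : piFB a 0 = 0 := by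
  rw [piFB_comm, piFB_zero_left ha]

theorem contDiffAt_piFB {u : ℝ × ℝ} (hu : u.1 ≠ 0 ∨ u.2 ≠ 0) :
    ContDiffAt ℝ 1 (fun v : ℝ × ℝ => piFB v.1 v.2) u := by
  have h : u.1 ^ 2 + u.2 ^ 2 ≠ 0 := by
    rcases hu with h | h <;> positivity
  have : ContDiffAt ℝ 1 (fun v : ℝ × ℝ => v.1 ^ 2 + v.2 ^ 2) u := by fun_prop
  exact ((this.sqrt h).sub contDiffAt_fst).sub contDiffAt_snd

/-- A Lipschitz function that is `C¹` off its zero set has a `C¹` square: at a zero, the square is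
of second order, and nearby its derivative `2u u'` is small because `u'` is bounded. -/
theorem contDiff_sq_of_lipschitzWith {E : Type*} [NormedAddCommGroup E] [NormedSpace ℝ E]
    {u : E → ℝ} {K : NNReal} (hu : LipschitzWith K u)
    (hd : ∀ x, u x ≠ 0 → ContDiffAt ℝ 1 u x) : ContDiff ℝ 1 (fun x => u x ^ 2) := by
  have hD : ∀ x, HasFDerivAt (fun x => u x ^ 2) ((2 * u x) • fderiv ℝ u x) x := by
    intro x
    by_cases hx : u x = 0
    · rw [hx, mul_zero, zero_smul, hasFDerivAt_iff_isLittleO_nhds_zero]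
      have h1 : (fun h : E => u (x + h) ^ 2 - u x ^ 2 - (0 : E →L[ℝ] ℝ) h)
          =O[𝓝 0] (fun h => ‖h‖ ^ 2) := by
        refine IsBigO.of_bound ((K : ℝ) ^ 2) (Eventually.of_forall fun h => ?_)
        have := hu.norm_sub_le (x + h) x
        rw [hx, sub_zero, add_sub_cancel_left] at this
        simp only [hx, norm_pow, norm_norm, ← mul_pow]
        simpa using pow_le_pow_left₀ (norm_nonneg _) this 2
      exact h1.trans_isLittleO (isLittleO_norm_pow_id one_lt_two)
    · have := ((hd x hx).differentiableAt one_ne_zero).hasFDerivAt.pow 2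
      simpa using this
  rw [contDiff_one_iff_fderiv]
  refine ⟨fun x => (hD x).differentiableAt, ?_⟩
  rw [show fderiv ℝ (fun x => u x ^ 2) = fun x => (2 * u x) • fderiv ℝ u x from
    funext fun x => (hD x).fderiv, continuous_iff_continuousAt]
  intro x
  by_cases hx : u x = 0
  · rw [ContinuousAt, hx, mul_zero, zero_smul]
    refine squeeze_zero_norm (a := fun y => |2 * u y| * K) (fun y => ?_) ?_
    · rw [norm_smul, Real.norm_eq_abs]
      gcongr
      exact norm_fderiv_le_of_lipschitz ℝ hu
    · have : Continuous fun y => |2 * u y| * (K : ℝ) := by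
        have := hu.continuous
        fun_prop
      simpa [hx] using this.tendsto x
  · exact (hu.continuous.continuousAt.const_mul 2).smul
      ((hd x hx).continuousAt_fderiv one_ne_zero)

theorem lipschitzWith_of_abs_sub_le {u : ℝ × ℝ → ℝ} (K : NNReal)
    (h : ∀ v w : ℝ × ℝ, |u v - u w| ≤ K * (|v.1 - w.1| + |v.2 - w.2|)) :
    LipschitzWith (2 * K) u := by
  refine LipschitzWith.of_dist_le_mul fun v w => ?_
  rw [Real.dist_eq, dist_eq_norm]
  have h1 : |v.1 - w.1| ≤ ‖v - w‖ := norm_fst_le (v - w)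
  have h2 : |v.2 - w.2| ≤ ‖v - w‖ := norm_snd_le (v - w)
  calc _ ≤ _ := h v w
    _ ≤ K * (‖v - w‖ + ‖v - w‖) := by gcongr
    _ = _ := by push_cast; ring

theorem contDiff_piFB_sq : ContDiff ℝ 1 (fun v : ℝ × ℝ => piFB v.1 v.2 ^ 2) := by
  refine contDiff_sq_of_lipschitzWith
    (lipschitzWith_of_abs_sub_le 2 fun v w => abs_piFB_sub_le _ _ _ _) fun v hv => ?_
  apply contDiffAt_piFB
  by_contra! h
  rw [h.1, h.2, piFB_zero_left le_rfl] at hv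
  exact hv rfl

theorem contDiffAt_piFB_abs {v : ℝ × ℝ} (h1 : v.1 ≠ 0) (h2 : v.2 ≠ 0) :
    ContDiffAt ℝ 1 (fun v : ℝ × ℝ => piFB |v.1| |v.2|) v := by
  have ha : ContDiffAt ℝ 1 (fun v : ℝ × ℝ => (|v.1|, |v.2|)) v :=
    ((contDiffAt_abs h1).comp v contDiffAt_fst).prodMk ((contDiffAt_abs h2).comp v contDiffAt_snd)
  exact (contDiffAt_piFB (u := (|v.1|, |v.2|)) (Or.inl (by simpa using h1))).comp v ha

theorem contDiff_piFB_abs_sq : ContDiff ℝ 1 (fun v : ℝ × ℝ => piFB |v.1| |v.2| ^ 2) := by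
  refine contDiff_sq_of_lipschitzWith
    (lipschitzWith_of_abs_sub_le 2 fun v w => ?_) fun v hv => ?_
  · refine (abs_piFB_sub_le _ _ _ _).trans ?_
    have := abs_abs_sub_abs_le v.1 w.1
    have := abs_abs_sub_abs_le v.2 w.2
    simp only [NNReal.coe_ofNat]
    linarith
  · refine contDiffAt_piFB_abs (fun h => hv ?_) (fun h => hv ?_)
    · rw [h, abs_zero, piFB_zero_left (abs_nonneg _)]
    · rw [h, abs_zero, piFB_zero_right (abs_nonneg _)]

open Classical in
/-- The last component of `thetaFB`, as a function of `(μ, ν)`, written as a combination of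
compositions of `piFB` with Lipschitz functions. -/
theorem ite_piFB_abs_eq (s t : ℝ) : (if s ≤ 0 ∧ t ≤ 0 then 0 else piFB |s| |t|)
    = piFB (max s 0) |t| + piFB |s| (max t 0) - piFB (max s 0) (max t 0) := by
  have h0 : ∀ r : ℝ, piFB 0 |r| = 0 := fun r => piFB_zero_left (abs_nonneg r)
  have h0' : ∀ r : ℝ, piFB |r| 0 = 0 := fun r => piFB_zero_right (abs_nonneg r)
  rcases le_or_gt s 0 with hs | hs <;> rcases le_or_gt t 0 with ht | ht
  · simp [hs, ht, h0, h0', piFB_zero_left]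
  · rw [if_neg (by simp [ht]), max_eq_right hs, max_eq_left ht.le, abs_of_pos ht,
      piFB_zero_left ht.le]
    ring
  · rw [if_neg (by simp [hs]), max_eq_right ht, max_eq_left hs.le, abs_of_pos hs,
      piFB_zero_right hs.le]
    ring
  · rw [if_neg (by simp [hs]), max_eq_left hs.le, max_eq_left ht.le, abs_of_pos hs, abs_of_pos ht]
    ring

open Classical in
theorem contDiff_ite_piFB_abs_sq :
    ContDiff ℝ 1 (fun v : ℝ × ℝ => (if v.1 ≤ 0 ∧ v.2 ≤ 0 then 0 else piFB |v.1| |v.2|) ^ 2) := by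
  refine contDiff_sq_of_lipschitzWith
    (lipschitzWith_of_abs_sub_le 6 fun v w => ?_) fun v hv => ?_
  · rw [ite_piFB_abs_eq, ite_piFB_abs_eq]
    have h1 := abs_abs_sub_abs_le v.1 w.1
    have h2 := abs_abs_sub_abs_le v.2 w.2
    have h3 := abs_max_sub_max_le_abs v.1 w.1 0
    have h4 := abs_max_sub_max_le_abs v.2 w.2 0
    have k1 := abs_piFB_sub_le (max v.1 0) |v.2| (max w.1 0) |w.2|
    have k2 := abs_piFB_sub_le |v.1| (max v.2 0) |w.1| (max w.2 0)
    have k3 := abs_piFB_sub_le (max v.1 0) (max v.2 0) (max w.1 0) (max w.2 0)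
    simp only [NNReal.coe_ofNat]
    rw [abs_le] at k1 k2 k3 ⊢
    constructor <;> linarith [k1.1, k1.2, k2.1, k2.2, k3.1, k3.2]
  · have hs : ¬ (v.1 ≤ 0 ∧ v.2 ≤ 0) := fun h => hv (if_pos h)
    rw [if_neg hs] at hv
    refine (contDiffAt_piFB_abs (v := v) (fun h => hv ?_) (fun h => hv ?_)).congr_of_eventuallyEq ?_
    · rw [h, abs_zero, piFB_zero_left (abs_nonneg _)]
    · rw [h, abs_zero, piFB_zero_right (abs_nonneg _)]
    · have ho : IsOpen {u : ℝ × ℝ | ¬ (u.1 ≤ 0 ∧ u.2 ≤ 0)} :=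
        ((isClosed_le continuous_fst continuous_const).inter
          (isClosed_le continuous_snd continuous_const)).isOpen_compl
      filter_upwards [ho.mem_nhds hs] with u hu
      exact if_neg hu

theorem contDiff_thetaFB_sq (j : Fin 4) :
    ContDiff ℝ 1 (fun w : Fin 4 → ℝ => thetaFB w j ^ 2) := by
  have hc : ∀ i k : Fin 4, ContDiff ℝ 1 fun w : Fin 4 → ℝ => (w i, w k) := fun i k =>
    (contDiff_apply ℝ ℝ i).prodMk (contDiff_apply ℝ ℝ k)
  fin_cases j
  · simpa [Function.comp_def, thetaFB] using contDiff_piFB_sq.comp (hc 0 1)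
  · simpa [Function.comp_def, thetaFB] using contDiff_piFB_abs_sq.comp (hc 0 2)
  · simpa [Function.comp_def, thetaFB] using contDiff_piFB_abs_sq.comp (hc 1 3)
  · simpa [Function.comp_def, thetaFB] using contDiff_ite_piFB_abs_sq.comp (hc 2 3)

/-! ### The functions `φ₁` and `φ₂` -/

namespace NewtonPair

/-- The pair `u` is one of the linear functions `± w_j`, evaluated at `w`. -/
def IsSignedCoord (w : Fin 4 → ℝ) (u : NewtonPair) (j : Fin 4) : Prop :=
  u = coord w j ∨ u = neg (coord w j)

theorem isSignedCoord_abs_coord (w : Fin 4 → ℝ) (j : Fin 4) :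
    IsSignedCoord w (abs (coord w j)) j := by
  unfold abs
  split_ifs
  · exact Or.inl rfl
  · exact Or.inr rfl

namespace IsSignedCoord

variable {w : Fin 4 → ℝ} {u : NewtonPair} {j : Fin 4}

theorem snd (h : IsSignedCoord w u j) : u.2 = Pi.single j 1 ∨ u.2 = -Pi.single j 1 := by
  rcases h with rfl | rfl
  · exact Or.inl rfl
  · exact Or.inr rfl

theorem abs_fst (h : IsSignedCoord w u j) : |u.1| = |w j| := by
  rcases h with rfl | rfl
  · rfl
  · exact abs_neg _

theorem fst_eq (h : IsSignedCoord w u j) : u.1 = u.2 ⬝ᵥ w := by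
  rcases h with rfl | rfl <;> simp [coord, neg]

end IsSignedCoord

theorem max_eq_or (u v : NewtonPair) : max u v = u ∨ max u v = v := by
  unfold max; split_ifs <;> simp

theorem min_eq_or (u v : NewtonPair) : min u v = u ∨ min u v = v := by
  unfold min; split_ifs <;> simp

theorem psi1_eq_or (w : Fin 4 → ℝ) :
    psi1 w = neg (coord w 0) ∨ psi1 w = abs (coord w 1) ∨ psi1 w = abs (coord w 2) := by
  unfold psi1
  rcases max_eq_or (neg (coord w 0)) (max (abs (coord w 1)) (abs (coord w 2))) with h | h
  · exact Or.inl h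
  · rw [h]; exact Or.inr (max_eq_or _ _)

theorem psi2_eq_or (w : Fin 4 → ℝ) :
    psi2 w = neg (coord w 1) ∨ psi2 w = abs (coord w 0) ∨ psi2 w = abs (coord w 3) := by
  unfold psi2
  rcases max_eq_or (neg (coord w 1)) (max (abs (coord w 0)) (abs (coord w 3))) with h | h
  · exact Or.inl h
  · rw [h]; exact Or.inr (max_eq_or _ _)

theorem psi3_eq_or (w : Fin 4 → ℝ) :
    psi3 w = abs (coord w 0) ∨ psi3 w = abs (coord w 1) ∨ psi3 w = coord w 2
      ∨ psi3 w = coord w 3 := by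
  unfold psi3
  rcases max_eq_or (abs (coord w 0)) (max (abs (coord w 1)) (max (coord w 2) (coord w 3)))
    with h | h
  · exact Or.inl h
  rw [h]
  rcases max_eq_or (abs (coord w 1)) (max (coord w 2) (coord w 3)) with h | h
  · exact Or.inr (Or.inl h)
  rw [h]
  exact Or.inr (Or.inr (max_eq_or _ _))

theorem psi1_fst (w : Fin 4 → ℝ) : (psi1 w).1 = Max.max (-w 0) (Max.max |w 1| |w 2|) := by
  simp only [psi1, max_fst, abs_fst, neg, coord]

theorem psi2_fst (w : Fin 4 → ℝ) : (psi2 w).1 = Max.max (-w 1) (Max.max |w 0| |w 3|) := by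
  simp only [psi2, max_fst, abs_fst, neg, coord]

theorem psi3_fst (w : Fin 4 → ℝ) :
    (psi3 w).1 = Max.max |w 0| (Max.max |w 1| (Max.max (w 2) (w 3))) := by
  simp only [psi3, max_fst, abs_fst, coord]

theorem phi1_eq_or (w : Fin 4 → ℝ) :
    phi1 w = psi1 w ∨ phi1 w = psi2 w ∨ phi1 w = psi3 w := by
  unfold phi1
  rcases min_eq_or (psi1 w) (min (psi2 w) (psi3 w)) with h | h
  · exact Or.inl h
  · rw [h]; exact Or.inr (min_eq_or _ _)

theorem phi1_le (w : Fin 4 → ℝ) :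
    (phi1 w).1 ≤ (psi1 w).1 ∧ (phi1 w).1 ≤ (psi2 w).1 ∧ (phi1 w).1 ≤ (psi3 w).1 := by
  simp only [phi1, min_fst]
  exact ⟨min_le_left _ _, (min_le_right _ _).trans (min_le_left _ _),
    (min_le_right _ _).trans (min_le_right _ _)⟩

theorem phi1_nonneg (w : Fin 4 → ℝ) : 0 ≤ (phi1 w).1 := by
  rw [phi1_fst]
  refine le_min ?_ (le_min ?_ ?_)
  · exact ((abs_nonneg _).trans (le_max_left _ _)).trans (le_max_right _ _)
  · exact ((abs_nonneg _).trans (le_max_left _ _)).trans (le_max_right _ _)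
  · exact (abs_nonneg _).trans (le_max_left _ _)

/-- The set of complementarity and multiplier conditions is measured by `φ₁`: each of the
elementary residuals is at most `φ₁`. -/
theorem residuals_le_phi1 (w : Fin 4 → ℝ) :
    |Min.min (w 0) (w 1)| ≤ (phi1 w).1 ∧ Min.min |w 0| |w 2| ≤ (phi1 w).1 ∧
    Min.min |w 1| |w 3| ≤ (phi1 w).1 ∧
    ((w 2 ≤ 0 ∧ w 3 ≤ 0) ∨ Min.min |w 2| |w 3| ≤ (phi1 w).1) := by
  rcases phi1_eq_or w with h | h | h <;> rw [h]
  · have e := psi1_fst w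
    have h1 : -w 0 ≤ (psi1 w).1 := e ▸ le_max_left _ _
    have h2 : |w 1| ≤ (psi1 w).1 := e ▸ (le_max_left _ _).trans (le_max_right _ _)
    have h3 : |w 2| ≤ (psi1 w).1 := e ▸ (le_max_right _ _).trans (le_max_right _ _)
    refine ⟨?_, (min_le_right _ _).trans h3, (min_le_left _ _).trans h2,
      Or.inr ((min_le_left _ _).trans h3)⟩
    rw [abs_le] at h2 ⊢
    exact ⟨le_min (by linarith) h2.1, (min_le_right _ _).trans h2.2⟩
  · have e := psi2_fst w
    have h1 : -w 1 ≤ (psi2 w).1 := e ▸ le_max_left _ _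
    have h2 : |w 0| ≤ (psi2 w).1 := e ▸ (le_max_left _ _).trans (le_max_right _ _)
    have h3 : |w 3| ≤ (psi2 w).1 := e ▸ (le_max_right _ _).trans (le_max_right _ _)
    refine ⟨?_, (min_le_left _ _).trans h2, (min_le_right _ _).trans h3,
      Or.inr ((min_le_right _ _).trans h3)⟩
    rw [abs_le] at h2 ⊢
    exact ⟨le_min h2.1 (by linarith), (min_le_left _ _).trans h2.2⟩
  · have e := psi3_fst w
    have h1 : |w 0| ≤ (psi3 w).1 := e ▸ le_max_left _ _
    have h2 : |w 1| ≤ (psi3 w).1 := e ▸ (le_max_left _ _).trans (le_max_right _ _)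
    have h3 : w 2 ≤ (psi3 w).1 :=
      e ▸ ((le_max_left _ _).trans (le_max_right _ _)).trans (le_max_right _ _)
    have h4 : w 3 ≤ (psi3 w).1 :=
      e ▸ ((le_max_right _ _).trans (le_max_right _ _)).trans (le_max_right _ _)
    refine ⟨?_, (min_le_left _ _).trans h1, (min_le_left _ _).trans h2, ?_⟩
    · rw [abs_le] at h1 h2 ⊢
      exact ⟨le_min h1.1 h2.1, (min_le_left _ _).trans h1.2⟩
    · rcases le_or_gt (w 2) 0 with h5 | h5
      · rcases le_or_gt (w 3) 0 with h6 | h6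
        · exact Or.inl ⟨h5, h6⟩
        · exact Or.inr ((min_le_right _ _).trans (by rwa [abs_of_pos h6]))
      · exact Or.inr ((min_le_left _ _).trans (by rwa [abs_of_pos h5]))

/-- Conversely, `φ₁` is at most the largest of the elementary residuals. -/
theorem phi1_le_of_residuals_le {w : Fin 4 → ℝ} {ε : ℝ} (h01 : |Min.min (w 0) (w 1)| ≤ ε)
    (h02 : Min.min |w 0| |w 2| ≤ ε) (h13 : Min.min |w 1| |w 3| ≤ ε)
    (h23 : (w 2 ≤ 0 ∧ w 3 ≤ 0) ∨ Min.min |w 2| |w 3| ≤ ε) : (phi1 w).1 ≤ ε := by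
  obtain ⟨k1, k2, k3⟩ := phi1_le w
  rw [psi1_fst] at k1
  rw [psi2_fst] at k2
  rw [psi3_fst] at k3
  have hε : 0 ≤ ε := (abs_nonneg _).trans h01
  rw [abs_le] at h01
  have ha : -w 0 ≤ ε := by linarith [min_le_left (w 0) (w 1)]
  have hb : -w 1 ≤ ε := by linarith [min_le_right (w 0) (w 1)]
  rcases le_or_gt |w 0| ε with h0 | h0 <;> rcases le_or_gt |w 1| ε with h1 | h1
  · rcases h23 with h | h
    · exact k3.trans (max_le h0 (max_le h1 (max_le (h.1.trans hε) (h.2.trans hε))))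
    · rcases min_le_iff.1 h with h | h
      · exact k1.trans (max_le ha (max_le h1 h))
      · exact k2.trans (max_le hb (max_le h0 h))
  · exact k2.trans (max_le hb (max_le h0 ((min_le_iff.1 h13).resolve_left h1.not_ge)))
  · exact k1.trans (max_le ha (max_le h1 ((min_le_iff.1 h02).resolve_left h0.not_ge)))
  · have h0' : ε < w 0 := by rcases lt_abs.1 h0 with h | h <;> linarith
    have h1' : ε < w 1 := by rcases lt_abs.1 h1 with h | h <;> linarith
    exact absurd (lt_min h0' h1') (not_lt.2 h01.2)

/-- When `φ₁` selects `± μ` (or `± ν`), it does so in a maximum that also contains `|b|`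
(or `|a|`); this is what makes the choice of `φ₂` in these cases consistent. -/
theorem phi1_snd_eq (w : Fin 4 → ℝ) : ∃ j, IsSignedCoord w (phi1 w) j ∧
    (j = 2 → |w 1| ≤ (phi1 w).1) ∧ (j = 3 → |w 0| ≤ (phi1 w).1) := by
  rcases phi1_eq_or w with h | h | h <;> rw [h]
  · rcases psi1_eq_or w with k | k | k
    · exact ⟨0, k ▸ Or.inr rfl, by simp, by simp⟩
    · exact ⟨1, k ▸ isSignedCoord_abs_coord w 1, by simp, by simp⟩
    · refine ⟨2, k ▸ isSignedCoord_abs_coord w 2, fun _ => ?_, by simp⟩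
      rw [psi1_fst]
      exact (le_max_left _ _).trans (le_max_right _ _)
  · rcases psi2_eq_or w with k | k | k
    · exact ⟨1, k ▸ Or.inr rfl, by simp, by simp⟩
    · exact ⟨0, k ▸ isSignedCoord_abs_coord w 0, by simp, by simp⟩
    · refine ⟨3, k ▸ isSignedCoord_abs_coord w 3, by simp, fun _ => ?_⟩
      rw [psi2_fst]
      exact (le_max_left _ _).trans (le_max_right _ _)
  · rcases psi3_eq_or w with k | k | k | k
    · exact ⟨0, k ▸ isSignedCoord_abs_coord w 0, by simp, by simp⟩
    · exact ⟨1, k ▸ isSignedCoord_abs_coord w 1, by simp, by simp⟩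
    · refine ⟨2, k ▸ Or.inl rfl, fun _ => ?_, by simp⟩
      rw [psi3_fst]
      exact (le_max_left _ _).trans (le_max_right _ _)
    · refine ⟨3, k ▸ Or.inl rfl, by simp, fun _ => ?_⟩
      rw [psi3_fst]
      exact le_max_left _ _

theorem not_signed_single_of_ne {i j : Fin 4} (h : i ≠ j) {v : Fin 4 → ℝ}
    (hv : v = Pi.single i 1 ∨ v = -Pi.single i 1) :
    ¬ (v = Pi.single j 1 ∨ v = -Pi.single j 1) := by
  rintro (rfl | rfl)
  · rcases hv with hv | hv
    · simpa [h.symm] using congrFun hv j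
    · simpa [h.symm] using congrFun hv j
  · rcases hv with hv | hv
    · simpa [h.symm] using congrFun hv j
    · simpa [h.symm] using congrFun hv j

/-- The pairs of coordinates of `(a, b, μ, ν)` that `(φ₁, φ₂)` can select:
`{a, b}`, `{a, ν}` and `{b, μ}`, in some order. -/
def IsSelectablePair (j k : Fin 4) : Prop :=
  (j = 0 ∧ (k = 1 ∨ k = 3)) ∨ (j = 1 ∧ (k = 0 ∨ k = 2)) ∨ (j = 2 ∧ k = 1) ∨ (j = 3 ∧ k = 0)

/-- Both `φ₁` and `φ₂` are signed coordinates, forming a selectable pair, and the selected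
coordinates are bounded by `φ₁`. -/
theorem exists_selectablePair (w : Fin 4 → ℝ) : ∃ j k, IsSelectablePair j k ∧
    IsSignedCoord w (phi1 w) j ∧ IsSignedCoord w (phi2 w) k ∧
    |w j| ≤ (phi1 w).1 ∧ |w k| ≤ (phi1 w).1 := by
  obtain ⟨j, hj, hj2, hj3⟩ := phi1_snd_eq w
  have hwj : |w j| ≤ (phi1 w).1 := by rw [← hj.abs_fst, abs_of_nonneg (phi1_nonneg w)]
  obtain ⟨-, r02, r13, -⟩ := residuals_le_phi1 w
  have hmin : ∀ i k, Min.min |w i| |w k| ≤ (phi1 w).1 →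
      ∃ r, (r = i ∨ r = k) ∧ IsSignedCoord w (min (abs (coord w i)) (abs (coord w k))) r ∧
        |w r| ≤ (phi1 w).1 := by
    intro i k hik
    have hf := min_fst (abs (coord w i)) (abs (coord w k))
    rw [NewtonPair.abs_fst, NewtonPair.abs_fst] at hf
    have hle : ∀ r, IsSignedCoord w (min (abs (coord w i)) (abs (coord w k))) r →
        |w r| ≤ (phi1 w).1 := by
      intro r hr
      rw [← hr.abs_fst, hf, abs_of_nonneg (le_min (abs_nonneg _) (abs_nonneg _))]
      exact hik
    rcases min_eq_or (abs (coord w i)) (abs (coord w k)) with h | h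
    · have : IsSignedCoord w (min (abs (coord w i)) (abs (coord w k))) i :=
        by rw [h]; exact isSignedCoord_abs_coord w i
      exact ⟨i, Or.inl rfl, this, hle i this⟩
    · have : IsSignedCoord w (min (abs (coord w i)) (abs (coord w k))) k :=
        by rw [h]; exact isSignedCoord_abs_coord w k
      exact ⟨k, Or.inr rfl, this, hle k this⟩
  have hjs := hj.snd
  obtain rfl | rfl | rfl | rfl : j = 0 ∨ j = 1 ∨ j = 2 ∨ j = 3 := by omega
  · obtain ⟨k, hk, hks, hkl⟩ := hmin 1 3 r13
    refine ⟨0, k, Or.inl ⟨rfl, hk⟩, hj, ?_, hwj, hkl⟩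
    rw [phi2, if_pos hjs]
    exact hks
  · obtain ⟨k, hk, hks, hkl⟩ := hmin 0 2 r02
    refine ⟨1, k, Or.inr (Or.inl ⟨rfl, hk⟩), hj, ?_, hwj, hkl⟩
    rw [phi2, if_neg (not_signed_single_of_ne (by decide) hjs), if_pos hjs]
    exact hks
  · refine ⟨2, 1, by simp [IsSelectablePair], hj, ?_, hwj, hj2 rfl⟩
    rw [phi2, if_neg (not_signed_single_of_ne (by decide) hjs),
      if_neg (not_signed_single_of_ne (by decide) hjs), if_pos hjs]
    exact isSignedCoord_abs_coord w 1
  · refine ⟨3, 0, by simp [IsSelectablePair], hj, ?_, hwj, hj3 rfl⟩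
    rw [phi2, if_neg (not_signed_single_of_ne (by decide) hjs),
      if_neg (not_signed_single_of_ne (by decide) hjs),
      if_neg (not_signed_single_of_ne (by decide) hjs)]
    exact isSignedCoord_abs_coord w 0

theorem abs_phi2_le (w : Fin 4 → ℝ) : |(phi2 w).1| ≤ (phi1 w).1 := by
  obtain ⟨j, k, -, -, hk, -, h⟩ := exists_selectablePair w
  rwa [hk.abs_fst]

theorem continuous_phi1 : Continuous fun w : Fin 4 → ℝ => (phi1 w).1 := by
  simp only [phi1_fst]
  fun_prop

end NewtonPair

theorem abs_thetaFB_le (w : Fin 4 → ℝ) (j : Fin 4) : |thetaFB w j| ≤ 4 * (NewtonPair.phi1 w).1 := by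
  obtain ⟨h1, h2, h3, h4⟩ := NewtonPair.residuals_le_phi1 w
  have habs : ∀ s t : ℝ, |(min |s| |t|)| = min |s| |t| := fun s t =>
    abs_of_nonneg (le_min (abs_nonneg _) (abs_nonneg _))
  have key : ∀ s t : ℝ, min |s| |t| ≤ (NewtonPair.phi1 w).1 →
      |piFB |s| (|t|)| ≤ 4 * (NewtonPair.phi1 w).1 := by
    intro s t h
    have := abs_piFB_le |s| |t|
    rw [habs] at this
    linarith
  fin_cases j
  · have := abs_piFB_le (w 0) (w 1)
    simp only [thetaFB, Fin.zero_eta, Matrix.cons_val_zero, abs_abs]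
    linarith
  · exact key _ _ h2
  · exact key _ _ h3
  · simp only [thetaFB, Fin.reduceFinMk, Matrix.cons_val]
    split_ifs with h
    · rw [abs_zero]; linarith [NewtonPair.phi1_nonneg w]
    · exact key _ _ (h4.resolve_left h)

theorem phi1_le_of_abs_thetaFB_le {w : Fin 4 → ℝ} {ε : ℝ} (h : ∀ j, |thetaFB w j| ≤ ε) :
    (NewtonPair.phi1 w).1 ≤ 2 * ε := by
  have key : ∀ s t : ℝ, |piFB |s| (|t|)| ≤ ε → min |s| |t| ≤ 2 * ε := by
    intro s t h
    linarith [abs_min_le_piFB |s| |t|, le_abs_self (min |s| |t|)]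
  have h0 := h 0
  have h3 := h 3
  simp only [thetaFB, Matrix.cons_val, abs_abs] at h0 h3
  apply NewtonPair.phi1_le_of_residuals_le
  · linarith [abs_min_le_piFB (w 0) (w 1)]
  · exact key _ _ (h 1)
  · exact key _ _ (h 2)
  · by_cases hc : w 2 ≤ 0 ∧ w 3 ≤ 0
    · exact Or.inl hc
    · rw [if_neg hc] at h3
      exact Or.inr (key _ _ h3)

/-! ### Derivatives of the Lagrangian -/

theorem contDiff_gradient {E : Type*} [NormedAddCommGroup E] [InnerProductSpace ℝ E]
    [CompleteSpace E] {u : E → ℝ} (hu : ContDiff ℝ 2 u) : ContDiff ℝ 1 (gradient u) :=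
  (InnerProductSpace.toDual ℝ E).symm.contDiff.comp (hu.fderiv_right (by norm_num))

namespace PDSpace

variable {n l m p : ℕ}

/-- The projection `z ↦ x` as a continuous linear map. -/
def xCLM : PDSpace n l m p →L[ℝ] EuclideanSpace ℝ (Fin n) :=
  LinearMap.toContinuousLinearMap
    { toFun := x, map_add' := fun _ _ => rfl, map_smul' := fun _ _ => rfl }

@[simp] theorem xCLM_apply (z : PDSpace n l m p) : xCLM z = z.x := rfl

/-- The coordinate `z ↦ λ_i` as a continuous linear map. -/
def lamCLM (i : Fin l) : PDSpace n l m p →L[ℝ] ℝ := EuclideanSpace.proj (Sum.inr (Sum.inl i))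

/-- The coordinate `z ↦ η_i` as a continuous linear map. -/
def etaCLM (i : Fin m) : PDSpace n l m p →L[ℝ] ℝ :=
  EuclideanSpace.proj (Sum.inr (Sum.inr (Sum.inl i)))

/-- The coordinate `z ↦ μ_i` as a continuous linear map. -/
def muCLM (i : Fin p) : PDSpace n l m p →L[ℝ] ℝ :=
  EuclideanSpace.proj (Sum.inr (Sum.inr (Sum.inr (Sum.inl i))))

/-- The coordinate `z ↦ ν_i` as a continuous linear map. -/
def nuCLM (i : Fin p) : PDSpace n l m p →L[ℝ] ℝ :=
  EuclideanSpace.proj (Sum.inr (Sum.inr (Sum.inr (Sum.inr i))))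

@[simp] theorem lamCLM_apply (z : PDSpace n l m p) (i : Fin l) : lamCLM i z = z.lam i := rfl

@[simp] theorem etaCLM_apply (z : PDSpace n l m p) (i : Fin m) : etaCLM i z = z.eta i := rfl

@[simp] theorem muCLM_apply (z : PDSpace n l m p) (i : Fin p) : muCLM i z = z.mu i := rfl

@[simp] theorem nuCLM_apply (z : PDSpace n l m p) (i : Fin p) : nuCLM i z = z.nu i := rfl

theorem eq_zero_of_blocks {z : PDSpace n l m p} (hx : z.x = 0) (hl : ∀ i, z.lam i = 0)
    (he : ∀ i, z.eta i = 0) (hm : ∀ i, z.mu i = 0) (hn : ∀ i, z.nu i = 0) : z = 0 := by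
  ext i
  rcases i with i | i | i | i | i
  · exact congrArg (fun v : EuclideanSpace ℝ (Fin n) => v i) hx
  · exact hl i
  · exact he i
  · exact hm i
  · exact hn i

end PDSpace

open PDSpace

namespace MPCC

variable {n l m p : ℕ} {P : MPCC n l m p}

theorem gradient_lagrangian (hP : P.IsC2) (x : EuclideanSpace ℝ (Fin n)) (lam : Fin l → ℝ)
    (eta : Fin m → ℝ) (mu nu : Fin p → ℝ) :
    gradient (fun y => P.lagrangian y lam eta mu nu) x
      = gradient P.f x + ∑ j, lam j • gradient (P.g j) x + ∑ j, eta j • gradient (P.h j) x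
        + ∑ j, mu j • gradient (P.G j) x + ∑ j, nu j • gradient (P.H j) x := by
  have hd : ∀ {u : EuclideanSpace ℝ (Fin n) → ℝ}, ContDiff ℝ 2 u →
      HasFDerivAt u (fderiv ℝ u x) x := fun hu =>
    (hu.differentiable two_ne_zero x).hasFDerivAt
  have hs : ∀ {k : ℕ} (c : Fin k → ℝ) {u : Fin k → EuclideanSpace ℝ (Fin n) → ℝ},
      (∀ i, ContDiff ℝ 2 (u i)) →
      HasFDerivAt (fun y => ∑ i, c i * u i y) (∑ i, c i • fderiv ℝ (u i) x) x := fun c u hu =>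
    HasFDerivAt.fun_sum fun i _ => (hd (hu i)).const_mul (c i)
  have := ((((hd hP.f).add (hs lam hP.g)).add (hs eta hP.h)).add (hs mu hP.G)).add (hs nu hP.H)
  have h2 : fderiv ℝ (fun y => P.lagrangian y lam eta mu nu) x = _ := this.fderiv
  rw [gradient, h2]
  simp only [map_add, map_sum, map_smul]
  rfl

theorem gradLagrangian_eq (hP : P.IsC2) (z : PDSpace n l m p) :
    P.gradLagrangian z
      = gradient P.f z.x + ∑ j, z.lam j • gradient (P.g j) z.x
        + ∑ j, z.eta j • gradient (P.h j) z.x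
        + ∑ j, z.mu j • gradient (P.G j) z.x + ∑ j, z.nu j • gradient (P.H j) z.x :=
  gradient_lagrangian hP z.x z.lam z.eta z.mu z.nu

theorem hessLagrangian_eq (hP : P.IsC2) (z : PDSpace n l m p) :
    P.hessLagrangian z
      = fderiv ℝ (gradient P.f) z.x + ∑ j, z.lam j • fderiv ℝ (gradient (P.g j)) z.x
        + ∑ j, z.eta j • fderiv ℝ (gradient (P.h j)) z.x
        + ∑ j, z.mu j • fderiv ℝ (gradient (P.G j)) z.x
        + ∑ j, z.nu j • fderiv ℝ (gradient (P.H j)) z.x := by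
  have hd : ∀ {u : EuclideanSpace ℝ (Fin n) → ℝ}, ContDiff ℝ 2 u →
      HasFDerivAt (gradient u) (fderiv ℝ (gradient u) z.x) z.x := fun hu =>
    ((contDiff_gradient hu).differentiable one_ne_zero z.x).hasFDerivAt
  have hs : ∀ {k : ℕ} (c : Fin k → ℝ) {u : Fin k → EuclideanSpace ℝ (Fin n) → ℝ},
      (∀ i, ContDiff ℝ 2 (u i)) →
      HasFDerivAt (fun y => ∑ i, c i • gradient (u i) y)
        (∑ i, c i • fderiv ℝ (gradient (u i)) z.x) z.x := fun c u hu =>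
    HasFDerivAt.fun_sum fun i _ => (hd (hu i)).const_smul (c i)
  have h1 : gradient (fun y => P.lagrangian y z.lam z.eta z.mu z.nu) = _ :=
    funext fun y => gradient_lagrangian hP y z.lam z.eta z.mu z.nu
  rw [hessLagrangian, h1]
  exact (((((hd hP.f).add (hs z.lam hP.g)).add (hs z.eta hP.h)).add (hs z.mu hP.G)).add
    (hs z.nu hP.H)).fderiv

/-- The derivative of `z ↦ ∑ c_j(z) ∇u_j(x)`, for coefficients `c_j` linear in `z`. -/
def sumGradDeriv {k : ℕ} (c : Fin k → PDSpace n l m p →L[ℝ] ℝ)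
    (u : Fin k → EuclideanSpace ℝ (Fin n) → ℝ) (z : PDSpace n l m p) :
    PDSpace n l m p →L[ℝ] EuclideanSpace ℝ (Fin n) :=
  ∑ j, (c j z • (fderiv ℝ (gradient (u j)) z.x).comp xCLM + (c j).smulRight (gradient (u j) z.x))

theorem hasFDerivAt_sum_smul_gradient {k : ℕ} (c : Fin k → PDSpace n l m p →L[ℝ] ℝ)
    {u : Fin k → EuclideanSpace ℝ (Fin n) → ℝ} (hu : ∀ i, ContDiff ℝ 2 (u i))
    (z : PDSpace n l m p) :
    HasFDerivAt (fun z : PDSpace n l m p => ∑ j, c j z • gradient (u j) z.x)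
      (sumGradDeriv c u z) z := by
  refine HasFDerivAt.fun_sum fun j _ => ?_
  have h : HasFDerivAt (fun z : PDSpace n l m p => gradient (u j) z.x)
      ((fderiv ℝ (gradient (u j)) z.x).comp xCLM) z :=
    HasFDerivAt.comp z (((contDiff_gradient (hu j)).differentiable one_ne_zero
      (xCLM z)).hasFDerivAt) (xCLM (n := n) (l := l) (m := m) (p := p)).hasFDerivAt
  exact (c j).hasFDerivAt.smul h

/-- The derivative of `z ↦ ∇ₓL(z)`. -/
def gradLagrangianDeriv (P : MPCC n l m p) (z : PDSpace n l m p) :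
    PDSpace n l m p →L[ℝ] EuclideanSpace ℝ (Fin n) :=
  (fderiv ℝ (gradient P.f) z.x).comp xCLM + sumGradDeriv lamCLM P.g z + sumGradDeriv etaCLM P.h z
    + sumGradDeriv muCLM P.G z + sumGradDeriv nuCLM P.H z

theorem hasFDerivAt_gradLagrangian (hP : P.IsC2) (z : PDSpace n l m p) :
    HasFDerivAt P.gradLagrangian (P.gradLagrangianDeriv z) z := by
  have h : HasFDerivAt (fun z : PDSpace n l m p => gradient P.f z.x)
      ((fderiv ℝ (gradient P.f) z.x).comp xCLM) z :=
    HasFDerivAt.comp z (((contDiff_gradient hP.f).differentiable one_ne_zero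
      (xCLM z)).hasFDerivAt) (xCLM (n := n) (l := l) (m := m) (p := p)).hasFDerivAt
  rw [show P.gradLagrangian = _ from funext fun z => gradLagrangian_eq hP z]
  exact (((h.add (hasFDerivAt_sum_smul_gradient lamCLM hP.g z)).add
    (hasFDerivAt_sum_smul_gradient etaCLM hP.h z)).add
    (hasFDerivAt_sum_smul_gradient muCLM hP.G z)).add
    (hasFDerivAt_sum_smul_gradient nuCLM hP.H z)

theorem gradLagrangianDeriv_apply (hP : P.IsC2) (z d : PDSpace n l m p) :
    P.gradLagrangianDeriv z d = P.hessLagrangian z d.x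
        + ∑ j, d.lam j • gradient (P.g j) z.x + ∑ j, d.eta j • gradient (P.h j) z.x
        + ∑ j, d.mu j • gradient (P.G j) z.x + ∑ j, d.nu j • gradient (P.H j) z.x := by
  rw [hessLagrangian_eq hP]
  simp only [gradLagrangianDeriv, sumGradDeriv, add_apply,
    sum_apply, smul_apply, ContinuousLinearMap.comp_apply,
    ContinuousLinearMap.smulRight_apply, xCLM_apply, lamCLM_apply, etaCLM_apply, muCLM_apply,
    nuCLM_apply, Finset.sum_add_distrib]
  abel

theorem contDiff_gradLagrangian (hP : P.IsC2) : ContDiff ℝ 1 P.gradLagrangian := by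
  have hx : ContDiff ℝ 1 (fun z : PDSpace n l m p => z.x) := xCLM.contDiff
  have hs : ∀ {k : ℕ} (c : Fin k → PDSpace n l m p →L[ℝ] ℝ)
      {u : Fin k → EuclideanSpace ℝ (Fin n) → ℝ}, (∀ i, ContDiff ℝ 2 (u i)) →
      ContDiff ℝ 1 (fun z : PDSpace n l m p => ∑ j, c j z • gradient (u j) z.x) := fun c u hu =>
    ContDiff.sum fun j _ => (c j).contDiff.smul ((contDiff_gradient (hu j)).comp hx)
  rw [show P.gradLagrangian = _ from funext fun z => gradLagrangian_eq hP z]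
  exact (((((contDiff_gradient hP.f).comp hx).add (hs lamCLM hP.g)).add (hs etaCLM hP.h)).add
    (hs muCLM hP.G)).add (hs nuCLM hP.H)

/-! ### The merit function -/

theorem contDiff_comp_x {u : EuclideanSpace ℝ (Fin n) → ℝ} {k : WithTop ℕ∞}
    (hu : ContDiff ℝ k u) : ContDiff ℝ k (fun z : PDSpace n l m p => u z.x) :=
  hu.comp (xCLM (n := n) (l := l) (m := m) (p := p)).contDiff

theorem contDiff_compl (hP : P.IsC2) (i : Fin p) : ContDiff ℝ 2 (fun z => P.compl z i) := by
  rw [contDiff_pi]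
  intro j
  fin_cases j
  · exact contDiff_comp_x (hP.G i)
  · exact contDiff_comp_x (hP.H i)
  · exact (muCLM i).contDiff
  · exact (nuCLM i).contDiff

theorem contDiff_FFB_sq (hP : P.IsC2) (j : Fin n ⊕ Fin l ⊕ Fin m ⊕ (Fin p × Fin 4)) :
    ContDiff ℝ 1 (fun z => P.FFB z j ^ 2) := by
  rcases j with j | j | j | ⟨i, j⟩
  · exact (contDiff_euclidean.1 (contDiff_gradLagrangian hP) j).pow 2
  · have h : ContDiff ℝ 1 (fun z : PDSpace n l m p => P.g j z.x) :=
      contDiff_comp_x ((hP.g j).of_le one_le_two)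
    have h' : ContDiff ℝ 1 (fun z : PDSpace n l m p => z.lam j) := (lamCLM j).contDiff
    have h2 := contDiff_piFB_sq.comp (h.neg.prodMk h')
    simp only [Function.comp_def] at h2
    exact h2
  · have h : ContDiff ℝ 1 (fun z : PDSpace n l m p => P.h j z.x) :=
      contDiff_comp_x ((hP.h j).of_le one_le_two)
    exact h.pow 2
  · have h : ContDiff ℝ 1 (fun z => P.compl z i) := (contDiff_compl hP i).of_le one_le_two
    change ContDiff ℝ 1 (fun z => thetaFB (P.compl z i) j ^ 2)
    exact (contDiff_thetaFB_sq j).comp h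

theorem contDiff_merit (hP : P.IsC2) : ContDiff ℝ 1 P.merit := by
  have : P.merit = fun z => 1 / 2 * ∑ j, P.FFB z j ^ 2 := by
    funext z
    simp [merit, EuclideanSpace.norm_sq_eq]
  rw [this]
  exact contDiff_const.mul (ContDiff.sum fun j _ => contDiff_FFB_sq hP j)

theorem merit_nonneg (z : PDSpace n l m p) : 0 ≤ P.merit z := by
  unfold merit; positivity

theorem merit_eq_zero_iff {z : PDSpace n l m p} : P.merit z = 0 ↔ P.FFB z = 0 := by
  simp [merit]

end MPCC

/-! ### The residuals `F` and `F_FB` -/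

namespace NewtonPair

/-- `φ₁` vanishes exactly at the quadruples `(a, b, μ, ν)` that satisfy the complementarity and
the M-stationarity conditions. -/
theorem phi1_eq_zero_iff (w : Fin 4 → ℝ) : (phi1 w).1 = 0 ↔
    0 ≤ w 0 ∧ 0 ≤ w 1 ∧ w 0 * w 1 = 0 ∧ w 0 * w 2 = 0 ∧ w 1 * w 3 = 0 ∧
      ((w 2 ≤ 0 ∧ w 3 ≤ 0) ∨ w 2 * w 3 = 0) := by
  have habs : ∀ s t : ℝ, Min.min |s| |t| ≤ 0 ↔ s * t = 0 := fun s t => by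
    rw [min_le_iff, abs_nonpos_iff, abs_nonpos_iff, mul_eq_zero]
  constructor
  · intro h
    obtain ⟨h1, h2, h3, h4⟩ := residuals_le_phi1 w
    rw [h, habs] at h2 h3 h4
    rw [h, abs_nonpos_iff] at h1
    have h0 : 0 ≤ w 0 := h1 ▸ min_le_left _ _
    have h0' : 0 ≤ w 1 := h1 ▸ min_le_right _ _
    refine ⟨h0, h0', ?_, h2, h3, h4⟩
    rw [← habs, abs_of_nonneg h0, abs_of_nonneg h0', h1]
  · rintro ⟨h0, h1, h01, h2, h3, h4⟩
    rw [← habs] at h01 h2 h3 h4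
    refine le_antisymm (phi1_le_of_residuals_le ?_ h2 h3 h4) (phi1_nonneg w)
    rwa [abs_of_nonneg (le_min h0 h1), ← abs_of_nonneg h0, ← abs_of_nonneg h1]

end NewtonPair

theorem min_eq_zero_iff_nonneg (s t : ℝ) : min s t = 0 ↔ 0 ≤ s ∧ 0 ≤ t ∧ (s = 0 ∨ t = 0) := by
  constructor
  · intro h
    refine ⟨h ▸ min_le_left s t, h ▸ min_le_right s t, ?_⟩
    rcases min_choice s t with h' | h' <;> rw [h] at h'
    · exact Or.inl h'.symm
    · exact Or.inr h'.symm
  · rintro ⟨hs, ht, rfl | rfl⟩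
    · exact min_eq_left ht
    · exact min_eq_right hs

theorem EuclideanSpace.norm_le_of_abs_le {ι : Type*} [Fintype ι] {v : EuclideanSpace ℝ ι} {c : ℝ}
    (hc : 0 ≤ c) (h : ∀ i, |v i| ≤ c) : ‖v‖ ≤ √(Fintype.card ι) * c := by
  rw [EuclideanSpace.norm_eq, ← Real.sqrt_sq hc, ← Real.sqrt_mul (Nat.cast_nonneg _)]
  refine Real.sqrt_le_sqrt ?_
  calc ∑ i, ‖v i‖ ^ 2 ≤ ∑ _i : ι, c ^ 2 := by
        refine Finset.sum_le_sum fun i _ => pow_le_pow_left₀ (norm_nonneg _) (h i) 2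
    _ = _ := by simp

theorem EuclideanSpace.abs_apply_le {ι : Type*} [Fintype ι] (v : EuclideanSpace ℝ ι) (i : ι) :
    |v i| ≤ ‖v‖ := PiLp.norm_apply_le v i

namespace MPCC

variable {n l m p : ℕ} {P : MPCC n l m p}

/-- The residuals of the nonsmooth system and of the Fischer-Burmeister reformulation are
globally equivalent. -/
theorem exists_norm_equiv (P : MPCC n l m p) : ∃ C : ℝ, 0 < C ∧ ∀ z : PDSpace n l m p,
    ‖P.F z‖ ≤ C * ‖P.FFB z‖ ∧ ‖P.FFB z‖ ≤ C * ‖P.F z‖ := by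
  set c₁ := √(Fintype.card (PDIndex n l m p))
  set c₂ := √(Fintype.card (Fin n ⊕ Fin l ⊕ Fin m ⊕ (Fin p × Fin 4)))
  have hF : ∀ z, ‖P.F z‖ ≤ c₁ * (2 * ‖P.FFB z‖) := by
    intro z
    have hphi : ∀ i, (NewtonPair.phi1 (P.compl z i)).1 ≤ 2 * ‖P.FFB z‖ := fun i =>
      phi1_le_of_abs_thetaFB_le fun j =>
        EuclideanSpace.abs_apply_le (P.FFB z) (Sum.inr (Sum.inr (Sum.inr (i, j))))
    refine EuclideanSpace.norm_le_of_abs_le (by positivity) fun j => ?_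
    have hn := norm_nonneg (P.FFB z)
    rcases j with j | j | j | j | j
    · exact (EuclideanSpace.abs_apply_le (P.FFB z) (Sum.inl j)).trans (by linarith)
    · refine (abs_min_le_piFB _ _).trans ?_
      gcongr
      exact EuclideanSpace.abs_apply_le (P.FFB z) (Sum.inr (Sum.inl j))
    · exact (EuclideanSpace.abs_apply_le (P.FFB z) (Sum.inr (Sum.inr (Sum.inl j)))).trans
        (by linarith)
    · exact (abs_of_nonneg (NewtonPair.phi1_nonneg _)).trans_le (hphi j)
    · exact (NewtonPair.abs_phi2_le _).trans (hphi j)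
  have hFFB : ∀ z, ‖P.FFB z‖ ≤ c₂ * (4 * ‖P.F z‖) := by
    intro z
    refine EuclideanSpace.norm_le_of_abs_le (by positivity) fun j => ?_
    have hn := norm_nonneg (P.F z)
    rcases j with j | j | j | ⟨i, j⟩
    · exact (EuclideanSpace.abs_apply_le (P.F z) (Sum.inl j)).trans (by linarith)
    · refine (abs_piFB_le _ _).trans ?_
      gcongr
      exact EuclideanSpace.abs_apply_le (P.F z) (Sum.inr (Sum.inl j))
    · exact (EuclideanSpace.abs_apply_le (P.F z) (Sum.inr (Sum.inr (Sum.inl j)))).trans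
        (by linarith)
    · refine (abs_thetaFB_le _ j).trans ?_
      gcongr
      exact (le_abs_self _).trans
        (EuclideanSpace.abs_apply_le (P.F z) (Sum.inr (Sum.inr (Sum.inr (Sum.inl i)))))
  refine ⟨2 * c₁ + 4 * c₂ + 1, by positivity, fun z => ⟨(hF z).trans ?_, (hFFB z).trans ?_⟩⟩
  · have : 0 ≤ (4 * c₂ + 1) * ‖P.FFB z‖ := by positivity
    linarith
  · have : 0 ≤ (2 * c₁ + 1) * ‖P.F z‖ := by positivity
    linarith

theorem F_eq_zero_iff_FFB_eq_zero {z : PDSpace n l m p} : P.F z = 0 ↔ P.FFB z = 0 := by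
  obtain ⟨C, -, h⟩ := P.exists_norm_equiv
  constructor <;> intro hz
  · have := (h z).2
    rw [hz, norm_zero, mul_zero] at this
    exact norm_le_zero_iff.1 this
  · have := (h z).1
    rw [hz, norm_zero, mul_zero] at this
    exact norm_le_zero_iff.1 this

theorem merit_eq_zero_iff_F {z : PDSpace n l m p} : P.merit z = 0 ↔ P.F z = 0 := by
  rw [merit_eq_zero_iff, F_eq_zero_iff_FFB_eq_zero]

theorem F_eq_zero_iff_blocks {z : PDSpace n l m p} : P.F z = 0 ↔
    P.gradLagrangian z = 0 ∧ (∀ i, min (-P.g i z.x) (z.lam i) = 0) ∧ (∀ i, P.h i z.x = 0) ∧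
      ∀ i, (NewtonPair.phi1 (P.compl z i)).1 = 0 := by
  constructor
  · intro h
    have hj : ∀ j, P.F z j = 0 := fun j => by rw [h]; rfl
    refine ⟨?_, fun i => hj (Sum.inr (Sum.inl i)), fun i => hj (Sum.inr (Sum.inr (Sum.inl i))),
      fun i => hj (Sum.inr (Sum.inr (Sum.inr (Sum.inl i))))⟩
    ext i
    exact hj (Sum.inl i)
  · rintro ⟨h1, h2, h3, h4⟩
    ext j
    rcases j with j | j | j | j | j
    · exact congrArg (fun v : EuclideanSpace ℝ (Fin n) => v j) h1
    · exact h2 j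
    · exact h3 j
    · exact h4 j
    · have := NewtonPair.abs_phi2_le (P.compl z j)
      rw [h4 j] at this
      exact abs_nonpos_iff.1 this

/-- The M-stationary tuples are the zeros of the nonsmooth system. -/
theorem isMStationaryTuple_iff {z : PDSpace n l m p} : P.IsMStationaryTuple z ↔ P.F z = 0 := by
  rw [F_eq_zero_iff_blocks]
  constructor
  · intro h
    refine ⟨h.grad_eq_zero, fun i => ?_, h.feasible.h_eq_zero, fun i => ?_⟩
    · rw [min_eq_zero_iff_nonneg]
      have := h.feasible.g_nonpos i
      by_cases hi : i ∈ P.activeG z.x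
      · have h0 : P.g i z.x = 0 := hi
        exact ⟨by linarith, h.lam_nonneg i hi, Or.inl (by rw [h0, neg_zero])⟩
      · have h0 := h.lam_eq_zero i hi
        exact ⟨by linarith, h0.ge, Or.inr h0⟩
    · rw [NewtonPair.phi1_eq_zero_iff]
      have hG := h.feasible.G_nonneg i
      have hH := h.feasible.H_nonneg i
      have hGH : P.G i z.x * P.H i z.x = 0 :=
        (Finset.sum_eq_zero_iff_of_nonneg fun i _ =>
          mul_nonneg (h.feasible.G_nonneg i) (h.feasible.H_nonneg i)).1
          h.feasible.complementary i (Finset.mem_univ i)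
      change 0 ≤ P.G i z.x ∧ 0 ≤ P.H i z.x ∧ P.G i z.x * P.H i z.x = 0 ∧
        P.G i z.x * z.mu i = 0 ∧ P.H i z.x * z.nu i = 0 ∧
        ((z.mu i ≤ 0 ∧ z.nu i ≤ 0) ∨ z.mu i * z.nu i = 0)
      refine ⟨hG, hH, hGH, ?_⟩
      rcases hG.eq_or_lt with hG0 | hG0
      · rcases hH.eq_or_lt with hH0 | hH0
        · refine ⟨by rw [← hG0, zero_mul], by rw [← hH0, zero_mul], ?_⟩
          rcases h.biactive i ⟨hG0.symm, hH0.symm⟩ with k | k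
          · exact Or.inr k
          · exact Or.inl ⟨k.1.le, k.2.le⟩
        · have hn := h.nu_eq_zero i ⟨hG0.symm, hH0⟩
          exact ⟨by rw [← hG0, zero_mul], by rw [hn, mul_zero], Or.inr (by rw [hn, mul_zero])⟩
      · have hH0 := (mul_eq_zero.1 hGH).resolve_left hG0.ne'
        have hm := h.mu_eq_zero i ⟨hG0, hH0⟩
        exact ⟨by rw [hm, mul_zero], by rw [hH0, zero_mul], Or.inr (by rw [hm, zero_mul])⟩
  · rintro ⟨h1, h2, h3, h4⟩
    have h2' := fun i => (min_eq_zero_iff_nonneg _ _).1 (h2 i)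
    have h4' : ∀ i, 0 ≤ P.G i z.x ∧ 0 ≤ P.H i z.x ∧ P.G i z.x * P.H i z.x = 0 ∧
        P.G i z.x * z.mu i = 0 ∧ P.H i z.x * z.nu i = 0 ∧
        ((z.mu i ≤ 0 ∧ z.nu i ≤ 0) ∨ z.mu i * z.nu i = 0) := fun i =>
      (NewtonPair.phi1_eq_zero_iff _).1 (h4 i)
    refine ⟨⟨fun i => by linarith [(h2' i).1], h3, fun i => (h4' i).1, fun i => (h4' i).2.1,
      Finset.sum_eq_zero fun i _ => (h4' i).2.2.1⟩, h1, fun i _ => (h2' i).2.1, fun i hi => ?_,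
      fun i hi => ?_, fun i hi => ?_, fun i _ => ?_⟩
    · exact (h2' i).2.2.resolve_left fun h => hi (neg_eq_zero.1 h)
    · exact (mul_eq_zero.1 (h4' i).2.2.2.1).resolve_left hi.1.ne'
    · exact (mul_eq_zero.1 (h4' i).2.2.2.2.1).resolve_left hi.2.ne'
    · by_cases k : z.mu i * z.nu i = 0
      · exact Or.inl k
      · have k' := (h4' i).2.2.2.2.2.resolve_right k
        rw [mul_eq_zero, not_or] at k
        exact Or.inr ⟨k'.1.lt_of_ne k.1, k'.2.lt_of_ne k.2⟩

end MPCC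

/-! ### Smooth selections of the nonsmooth system -/

/-- The choices made in evaluating `F` at a point: for each inequality constraint whether
`min(-g_i, λ_i)` selects `-g_i` (`true`) or `λ_i` (`false`), and for each complementarity pair the
row vectors `Dφ₁(w_i)` and `Dφ₂(w_i)`. -/
abbrev Selection (l p : ℕ) : Type := (Fin l → Bool) × (Fin p → Fin 4 → ℝ) × (Fin p → Fin 4 → ℝ)

/-- The row vectors `± e_jᵀ`. -/
def signedUnitVectors : Set (Fin 4 → ℝ) := {c | ∃ j, c = Pi.single j 1 ∨ c = -Pi.single j 1}

theorem finite_signedUnitVectors : signedUnitVectors.Finite := by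
  have : signedUnitVectors = ⋃ j : Fin 4, {Pi.single j 1, -Pi.single j 1} := by
    ext c; simp [signedUnitVectors]
  rw [this]
  exact Set.finite_iUnion fun j => Set.toFinite _

/-- The selections whose row vectors are signed unit vectors. -/
def unitSelections (l p : ℕ) : Set (Selection l p) :=
  Set.univ ×ˢ (Set.univ.pi fun _ => signedUnitVectors) ×ˢ (Set.univ.pi fun _ => signedUnitVectors)

theorem finite_unitSelections (l p : ℕ) : (unitSelections l p).Finite :=
  Set.finite_univ.prod ((Set.Finite.pi' fun _ => finite_signedUnitVectors).subset
    (fun _ h => by simpa using h) |>.prod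
    ((Set.Finite.pi' fun _ => finite_signedUnitVectors).subset (fun _ h => by simpa using h)))

namespace MPCC

variable {n l m p : ℕ} {P : MPCC n l m p}

/-- The smooth map obtained from `F` by freezing the choices `s`. -/
def selF (P : MPCC n l m p) (s : Selection l p) (z : PDSpace n l m p) : PDSpace n l m p :=
  WithLp.toLp 2
    (Sum.elim (fun i => P.gradLagrangian z i)
      (Sum.elim (fun i => if s.1 i then -P.g i z.x else z.lam i)
        (Sum.elim (fun i => P.h i z.x)
          (Sum.elim (fun i => s.2.1 i ⬝ᵥ P.compl z i) (fun i => s.2.2 i ⬝ᵥ P.compl z i)))))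

open Classical in
/-- The choices made by `F` at `z`. -/
def sel (P : MPCC n l m p) (z : PDSpace n l m p) : Selection l p :=
  (fun i => decide (-P.g i z.x ≤ z.lam i), fun i => (NewtonPair.phi1 (P.compl z i)).2,
    fun i => (NewtonPair.phi2 (P.compl z i)).2)

theorem sel_mem_unitSelections (z : PDSpace n l m p) : P.sel z ∈ unitSelections l p := by
  refine ⟨trivial, fun i _ => ?_, fun i _ => ?_⟩
  · obtain ⟨j, k, -, hj, -⟩ := NewtonPair.exists_selectablePair (P.compl z i)
    exact ⟨j, hj.snd⟩
  · obtain ⟨j, k, -, -, hk, -⟩ := NewtonPair.exists_selectablePair (P.compl z i)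
    exact ⟨k, hk.snd⟩

theorem selF_sel (z : PDSpace n l m p) : P.selF (P.sel z) z = P.F z := by
  ext j
  rcases j with j | j | j | j | j
  · rfl
  · simp only [selF, sel, F, Sum.elim_inr, Sum.elim_inl, decide_eq_true_eq, min_def]
  · rfl
  · obtain ⟨i, k, -, hi, -⟩ := NewtonPair.exists_selectablePair (P.compl z j)
    exact hi.fst_eq.symm
  · obtain ⟨i, k, -, -, hk, -⟩ := NewtonPair.exists_selectablePair (P.compl z j)
    exact hk.fst_eq.symm

theorem contDiff_selF_apply (hP : P.IsC2) (s : Selection l p) (j : Fin l ⊕ Fin m ⊕ Fin p ⊕ Fin p) :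
    ContDiff ℝ 2 (fun z => P.selF s z (Sum.inr j)) := by
  have hdot : ∀ (c : Fin 4 → ℝ) i, ContDiff ℝ 2 (fun z => c ⬝ᵥ P.compl z i) := fun c i =>
    ContDiff.sum fun k _ => contDiff_const.mul (contDiff_pi.1 (contDiff_compl hP i) k)
  rcases j with j | j | j | j
  · change ContDiff ℝ 2 (fun z : PDSpace n l m p => if s.1 j then -P.g j z.x else z.lam j)
    split_ifs
    · exact (contDiff_comp_x (hP.g j)).neg
    · exact (lamCLM j).contDiff
  · exact contDiff_comp_x (hP.h j)
  · exact hdot (s.2.1 j) j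
  · exact hdot (s.2.2 j) j

theorem contDiff_selF (hP : P.IsC2) (s : Selection l p) : ContDiff ℝ 1 (P.selF s) := by
  rw [contDiff_euclidean]
  rintro (j | j)
  · exact contDiff_euclidean.1 (contDiff_gradLagrangian hP) j
  · exact (contDiff_selF_apply hP s j).of_le one_le_two

theorem fderiv_comp_x {u : EuclideanSpace ℝ (Fin n) → ℝ} (hu : ContDiff ℝ 2 u)
    (z d : PDSpace n l m p) :
    fderiv ℝ (fun z : PDSpace n l m p => u z.x) z d = inner ℝ (gradient u z.x) d.x := by
  have h : HasFDerivAt (fun z : PDSpace n l m p => u z.x) ((fderiv ℝ u z.x).comp xCLM) z :=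
    HasFDerivAt.comp z ((hu.differentiable two_ne_zero (xCLM z)).hasFDerivAt)
      (xCLM (n := n) (l := l) (m := m) (p := p)).hasFDerivAt
  rw [h.fderiv, inner_gradient_left]
  rfl

theorem fderiv_dotProduct_compl (hP : P.IsC2) (c : Fin 4 → ℝ) (i : Fin p)
    (z d : PDSpace n l m p) :
    fderiv ℝ (fun z => c ⬝ᵥ P.compl z i) z d = c ⬝ᵥ P.complDeriv z d i := by
  have hd : ∀ j, DifferentiableAt ℝ (fun z => P.compl z i j) z := fun j =>
    (contDiff_pi.1 (contDiff_compl hP i) j).differentiable two_ne_zero z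
  have h1 : ∀ j, fderiv ℝ (fun z => P.compl z i j) z d = P.complDeriv z d i j := by
    intro j
    fin_cases j
    · exact fderiv_comp_x (hP.G i) z d
    · exact fderiv_comp_x (hP.H i) z d
    · exact congrArg (fun A : PDSpace n l m p →L[ℝ] ℝ => A d) (muCLM i).fderiv
    · exact congrArg (fun A : PDSpace n l m p →L[ℝ] ℝ => A d) (nuCLM i).fderiv
  have h2 : HasFDerivAt (fun z => c ⬝ᵥ P.compl z i)
      (∑ j, c j • fderiv ℝ (fun z => P.compl z i j) z) z :=
    HasFDerivAt.fun_sum fun j _ => (hd j).hasFDerivAt.const_mul (c j)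
  rw [h2.fderiv]
  simp [h1, dotProduct]

/-- The components of the derivative of a smooth selection. -/
theorem fderiv_selF_apply (hP : P.IsC2) (s : Selection l p) (z d : PDSpace n l m p) :
    fderiv ℝ (P.selF s) z d = WithLp.toLp 2
      (Sum.elim (fun i => P.gradLagrangianDeriv z d i)
        (Sum.elim
          (fun i => if s.1 i then -inner ℝ (gradient (P.g i) z.x) d.x else d.lam i)
          (Sum.elim (fun i => inner ℝ (gradient (P.h i) z.x) d.x)
            (Sum.elim (fun i => s.2.1 i ⬝ᵥ P.complDeriv z d i)
              (fun i => s.2.2 i ⬝ᵥ P.complDeriv z d i))))) := by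
  have hd := ((contDiff_selF hP s).differentiable one_ne_zero z).hasFDerivAt
  have hj : ∀ j, HasFDerivAt (fun z => P.selF s z j)
      ((EuclideanSpace.proj j).comp (fderiv ℝ (P.selF s) z)) z := fun j =>
    (EuclideanSpace.proj j : PDSpace n l m p →L[ℝ] ℝ).hasFDerivAt.comp z hd
  have hv : ∀ j, fderiv ℝ (P.selF s) z d j = fderiv ℝ (fun z => P.selF s z j) z d := by
    intro j
    rw [(hj j).fderiv]
    rfl
  ext j
  rw [hv]
  rcases j with j | j | j | j | j
  · have h : HasFDerivAt (fun z => P.gradLagrangian z j)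
        ((EuclideanSpace.proj j).comp (P.gradLagrangianDeriv z)) z :=
      (EuclideanSpace.proj j : EuclideanSpace ℝ (Fin n) →L[ℝ] ℝ).hasFDerivAt.comp z
        (hasFDerivAt_gradLagrangian hP z)
    change fderiv ℝ (fun z => P.gradLagrangian z j) z d = _
    rw [h.fderiv]
    rfl
  · change fderiv ℝ (fun z : PDSpace n l m p => if s.1 j then -P.g j z.x else z.lam j) z d
      = if s.1 j then -inner ℝ (gradient (P.g j) z.x) d.x else d.lam j
    split_ifs
    · rw [fderiv_fun_neg, ← fderiv_comp_x (hP.g j)]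
      rfl
    · exact congrArg (fun A : PDSpace n l m p →L[ℝ] ℝ => A d) (lamCLM j).fderiv
  · exact fderiv_comp_x (hP.h j) z d
  · exact fderiv_dotProduct_compl hP _ j z d
  · exact fderiv_dotProduct_compl hP _ j z d

/-- The Newton derivative of `F` at `z` is the derivative of the smooth selection active at `z`. -/
theorem DF_apply (hP : P.IsC2) (z d : PDSpace n l m p) :
    P.DF z d = fderiv ℝ (P.selF (P.sel z)) z d := by
  rw [fderiv_selF_apply hP]
  ext j
  rcases j with j | j | j | j | j
  · simp only [gradLagrangianDeriv_apply hP]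
    rfl
  · simp only [DF, sel, LinearMap.coe_mk, AddHom.coe_mk, Sum.elim_inr, Sum.elim_inl,
      decide_eq_true_eq]
  · rfl
  · rfl
  · rfl

/-- The Newton derivative is discontinuous but locally bounded, as it is everywhere one of finitely
many continuous derivatives. -/
theorem exists_norm_DF_le (hP : P.IsC2) (zbar : PDSpace n l m p) :
    ∃ C, 0 < C ∧ ∀ᶠ z in 𝓝 zbar, ∀ d, ‖P.DF z d‖ ≤ C * ‖d‖ := by
  have hfin := finite_unitSelections l p
  obtain ⟨C, hC⟩ := (hfin.image fun s => ‖fderiv ℝ (P.selF s) zbar‖).bddAbove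
  refine ⟨|C| + 1, by positivity, ?_⟩
  have h : ∀ᶠ z in 𝓝 zbar, ∀ s ∈ unitSelections l p, ‖fderiv ℝ (P.selF s) z‖ < |C| + 1 := by
    rw [hfin.eventually_all]
    intro s hs
    have hc : Continuous fun z => ‖fderiv ℝ (P.selF s) z‖ :=
      ((contDiff_selF hP s).continuous_fderiv one_ne_zero).norm
    refine hc.continuousAt.eventually_lt continuousAt_const ?_
    have := hC (Set.mem_image_of_mem _ hs)
    linarith [le_abs_self C]
  filter_upwards [h] with z hz d
  rw [DF_apply hP]
  exact (ContinuousLinearMap.le_opNorm _ _).trans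
    (mul_le_mul_of_nonneg_right (hz _ (sel_mem_unitSelections z)).le (norm_nonneg d))

end MPCC

/-! ### Linearization errors and uniform invertibility -/

section Calculus

variable {E V : Type*} [NormedAddCommGroup E] [NormedSpace ℝ E] [NormedAddCommGroup V]
  [NormedSpace ℝ V]

/-- For a `C¹` function, the linearization at the moving point is also of first order. -/
theorem ContDiff.isLittleO_linearization {u : E → V} (hu : ContDiff ℝ 1 u) (x : E) :
    (fun y => u y - u x - fderiv ℝ u y (y - x)) =o[𝓝 x] fun y => y - x := by
  have h1 := ((hu.differentiable one_ne_zero x).hasFDerivAt).isLittleO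
  have h2 : (fun y => (fderiv ℝ u y - fderiv ℝ u x) (y - x)) =o[𝓝 x] fun y => y - x := by
    rw [isLittleO_iff]
    intro c hc
    have hcont := (hu.continuous_fderiv one_ne_zero).continuousAt (x := x)
    filter_upwards [Metric.continuousAt_iff'.1 hcont c hc] with y hy
    rw [dist_eq_norm] at hy
    exact (ContinuousLinearMap.le_opNorm _ _).trans
      (mul_le_mul_of_nonneg_right hy.le (norm_nonneg _))
  refine (h1.sub h2).congr_left fun y => ?_
  simp only [sub_apply]
  abel

/-- If the derivative is locally Lipschitz, the linearization error at the moving point is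
quadratic. -/
theorem LocallyLipschitz.isBigO_linearization {u : E → V} (hu : Differentiable ℝ u)
    (hL : LocallyLipschitz (fderiv ℝ u)) (x : E) :
    (fun y => u y - u x - fderiv ℝ u y (y - x)) =O[𝓝 x] fun y => ‖y - x‖ ^ 2 := by
  obtain ⟨K, t, ht, hK⟩ := hL x
  obtain ⟨r, hr, hrt⟩ := Metric.mem_nhds_iff.1 ht
  refine IsBigO.of_bound K ?_
  filter_upwards [Metric.ball_mem_nhds x hr] with y hy
  have hseg : segment ℝ y x ⊆ Metric.ball x r :=
    (convex_ball x r).segment_subset hy (Metric.mem_ball_self hr)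
  have hb : ∀ w ∈ segment ℝ y x, ‖fderiv ℝ u w - fderiv ℝ u y‖ ≤ K * ‖x - y‖ := by
    intro w hw
    have h1 := hK.dist_le_mul w (hrt (hseg hw)) y (hrt hy)
    rw [dist_eq_norm, dist_eq_norm] at h1
    refine h1.trans ?_
    gcongr
    obtain ⟨a, b, ha, hb, hab, rfl⟩ := hw
    have : a • y + b • x - y = b • (x - y) := by
      rw [smul_sub, show a = 1 - b by linarith, sub_smul, one_smul]; abel
    rw [this, norm_smul, Real.norm_of_nonneg hb]
    exact mul_le_of_le_one_left (norm_nonneg _) (by linarith)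
  have h2 := (convex_segment y x).norm_image_sub_le_of_norm_fderiv_le'
    (fun w _ => hu w) hb (left_mem_segment ℝ y x) (right_mem_segment ℝ y x)
  have e : u y - u x - fderiv ℝ u y (y - x) = -(u x - u y - fderiv ℝ u y (x - y)) := by
    rw [← neg_sub x y, map_neg]; abel
  rw [e, norm_neg, Real.norm_of_nonneg (by positivity), sq, ← mul_assoc, norm_sub_rev y x]
  exact h2

theorem isBigO_euclidean {ι α : Type*} [Fintype ι] {v : α → EuclideanSpace ℝ ι} {w : α → ℝ}
    {L : Filter α} (h : ∀ i, (fun a => v a i) =O[L] w) : v =O[L] w := by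
  have h1 : (fun a => √(Fintype.card ι) * ∑ i, ‖v a i‖) =O[L] w :=
    (IsBigO.fun_sum fun i _ => (h i).norm_left).const_mul_left _
  refine (IsBigO.of_bound 1 (Eventually.of_forall fun a => ?_)).trans h1
  rw [one_mul]
  refine (EuclideanSpace.norm_le_of_abs_le (c := ∑ i, ‖v a i‖)
    (Finset.sum_nonneg fun i _ => norm_nonneg _) fun i => ?_).trans (le_abs_self _)
  exact Finset.single_le_sum (f := fun i => ‖v a i‖) (fun i _ => norm_nonneg _) (Finset.mem_univ i)

/-- Injectivity at a point of finitely many continuous families of linear maps on a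
finite-dimensional space yields a uniform bound of the inverses nearby. -/
theorem exists_norm_le_of_injective [FiniteDimensional ℝ E] {ι : Type*} {S : Set ι}
    (hS : S.Finite) {A : ι → E → E →L[ℝ] V} {x : E} (hA : ∀ s ∈ S, ContinuousAt (A s) x)
    (hinj : ∀ s ∈ S, ∀ d, A s x d = 0 → d = 0) :
    ∃ C, 0 < C ∧ ∀ᶠ y in 𝓝 x, ∀ s ∈ S, ∀ d, ‖d‖ ≤ C * ‖A s y d‖ := by
  have key : ∀ s : S, ∃ C : ℝ, 0 < C ∧ ∀ᶠ y in 𝓝 x, ∀ d, ‖d‖ ≤ C * ‖A s y d‖ := by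
    rintro ⟨s, hs⟩
    obtain ⟨K, hK, hanti⟩ := LinearMap.exists_antilipschitzWith (A s x : E →ₗ[ℝ] V)
      (LinearMap.ker_eq_bot'.2 (hinj s hs))
    have hK' : (0 : ℝ) < K := hK
    -- a perturbation of norm less than `1 / (2K)` at most doubles the bound `K` at `x`
    refine ⟨2 * K, by positivity, ?_⟩
    filter_upwards [Metric.continuousAt_iff'.1 (hA s hs) (1 / (2 * K)) (by positivity)] with y hy d
    rw [dist_eq_norm] at hy
    have h1 : ‖d‖ ≤ K * ‖A s x d‖ := by
      have := hanti.le_mul_dist d 0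
      simpa using this
    have h2 : ‖A s x d‖ ≤ ‖A s y d‖ + 1 / (2 * K) * ‖d‖ := by
      have h3 : A s x d = A s y d - (A s y - A s x) d := by simp
      rw [h3]
      refine (norm_sub_le _ _).trans ?_
      gcongr
      exact (ContinuousLinearMap.le_opNorm _ _).trans
        (mul_le_mul_of_nonneg_right hy.le (norm_nonneg _))
    have h4 : (K : ℝ) * (1 / (2 * K) * ‖d‖) = ‖d‖ / 2 := by field_simp
    nlinarith [mul_le_mul_of_nonneg_left h2 hK'.le]
  choose C hC hev using key
  have : Finite S := hS
  obtain ⟨M, hM⟩ := (Set.finite_range C).bddAbove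
  refine ⟨|M| + 1, by positivity, ?_⟩
  have h : ∀ᶠ y in 𝓝 x, ∀ s : S, ∀ d, ‖d‖ ≤ C s * ‖A s y d‖ := eventually_all.2 hev
  filter_upwards [h] with y hy s hs d
  refine (hy ⟨s, hs⟩ d).trans ?_
  gcongr
  have := hM (Set.mem_range_self ⟨s, hs⟩)
  linarith [le_abs_self M]

end Calculus

theorem LocallyLipschitz.fun_sum {α V ι : Type*} [PseudoEMetricSpace α] [NormedAddCommGroup V]
    (s : Finset ι) {u : ι → α → V} (h : ∀ i ∈ s, LocallyLipschitz (u i)) :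
    LocallyLipschitz fun a => ∑ i ∈ s, u i a := by
  classical
  induction s using Finset.induction_on with
  | empty => simpa using LocallyLipschitz.const (0 : V)
  | insert i s hi ih =>
    simp only [Finset.sum_insert hi]
    exact (h i (Finset.mem_insert_self i s)).add
      (ih fun j hj => h j (Finset.mem_insert_of_mem hj))

theorem sum_subtype_of_eq_zero {k : ℕ} {V : Type*} [AddCommMonoid V] (S : Set (Fin k))
    [Fintype S] {u : Fin k → V} (h : ∀ i ∉ S, u i = 0) : ∑ i : S, u i = ∑ i, u i := by
  classical
  rw [← Finset.sum_subtype S.toFinset (fun i => Set.mem_toFinset) u]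
  refine Finset.sum_subset (Finset.subset_univ _) fun i _ hi => h i ?_
  simpa using hi

namespace MPCC

variable {n l m p : ℕ} {P : MPCC n l m p}

/-! ### Selections that are active near an M-stationary tuple -/

/-- All quantities selected by `s` vanish at `zbar`, and the selected pairs of coordinates of
`(G_i, H_i, μ_i, ν_i)` are among those that `(φ₁, φ₂)` can select. -/
def IsConsistent (P : MPCC n l m p) (zbar : PDSpace n l m p) (s : Selection l p) : Prop :=
  (∀ i, (s.1 i = true ∧ P.g i zbar.x = 0) ∨ (s.1 i = false ∧ zbar.lam i = 0)) ∧
  ∀ i, ∃ j k, NewtonPair.IsSelectablePair j k ∧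
    (s.2.1 i = Pi.single j 1 ∨ s.2.1 i = -Pi.single j 1) ∧
    (s.2.2 i = Pi.single k 1 ∨ s.2.2 i = -Pi.single k 1) ∧
    P.compl zbar i j = 0 ∧ P.compl zbar i k = 0

/-- Near a zero of `F`, a quantity that does not vanish there is not selected: the selected
quantities are bounded by components of `F` that are continuous. -/
theorem eventually_isConsistent_sel (hP : P.IsC2) {zbar : PDSpace n l m p} (hF : P.F zbar = 0) :
    ∀ᶠ z in 𝓝 zbar, P.IsConsistent zbar (P.sel z) := by
  obtain ⟨-, hg, -, hphi⟩ := F_eq_zero_iff_blocks.1 hF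
  have hg' := fun i => (min_eq_zero_iff_nonneg _ _).1 (hg i)
  have hgc : ∀ i, ContinuousAt (fun z : PDSpace n l m p => -P.g i z.x) zbar := fun i =>
    (contDiff_comp_x (hP.g i)).neg.continuous.continuousAt
  have hlc : ∀ i, ContinuousAt (fun z : PDSpace n l m p => z.lam i) zbar := fun i =>
    (lamCLM i).continuous.continuousAt
  have e1 : ∀ᶠ z in 𝓝 zbar, ∀ i, P.g i zbar.x ≠ 0 → z.lam i < -P.g i z.x := by
    refine eventually_all.2 fun i => ?_
    by_cases h : P.g i zbar.x = 0
    · exact Eventually.of_forall fun z hz => absurd h hz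
    · have hl : zbar.lam i = 0 := (hg' i).2.2.resolve_left fun h' => h (neg_eq_zero.1 h')
      have hlt : zbar.lam i < -P.g i zbar.x := by
        rw [hl]; exact (hg' i).1.lt_of_ne fun h' => h (neg_eq_zero.1 h'.symm)
      exact ((hlc i).eventually_lt (hgc i) hlt).mono fun z hz _ => hz
  have e2 : ∀ᶠ z in 𝓝 zbar, ∀ i, zbar.lam i ≠ 0 → -P.g i z.x < z.lam i := by
    refine eventually_all.2 fun i => ?_
    by_cases h : zbar.lam i = 0
    · exact Eventually.of_forall fun z hz => absurd h hz
    · have hl : -P.g i zbar.x = 0 := (hg' i).2.2.resolve_right h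
      have hlt : -P.g i zbar.x < zbar.lam i := by
        rw [hl]; exact (hg' i).2.1.lt_of_ne (Ne.symm h)
      exact ((hgc i).eventually_lt (hlc i) hlt).mono fun z hz _ => hz
  have hcc : ∀ i, Continuous fun z => P.compl z i := fun i => (contDiff_compl hP i).continuous
  have e3 : ∀ᶠ z in 𝓝 zbar, ∀ i j, P.compl zbar i j ≠ 0 →
      (NewtonPair.phi1 (P.compl z i)).1 < |P.compl z i j| := by
    refine eventually_all.2 fun i => eventually_all.2 fun j => ?_
    by_cases h : P.compl zbar i j = 0
    · exact Eventually.of_forall fun z hz => absurd h hz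
    · have c1 : Continuous fun z => (NewtonPair.phi1 (P.compl z i)).1 :=
        NewtonPair.continuous_phi1.comp (hcc i)
      have c2 : Continuous fun z => |P.compl z i j| := ((continuous_apply j).comp (hcc i)).abs
      refine (c1.continuousAt.eventually_lt c2.continuousAt ?_).mono fun z hz _ => hz
      rw [hphi i]
      exact abs_pos.2 h
  filter_upwards [e1, e2, e3] with z h1 h2 h3
  refine ⟨fun i => ?_, fun i => ?_⟩
  · by_cases h : -P.g i z.x ≤ z.lam i
    · exact Or.inl ⟨decide_eq_true h, by_contra fun h' => (h1 i h').not_ge h⟩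
    · exact Or.inr ⟨decide_eq_false h, by_contra fun h' => h (h2 i h').le⟩
  · obtain ⟨j, k, hjk, hj, hk, hj', hk'⟩ := NewtonPair.exists_selectablePair (P.compl z i)
    exact ⟨j, k, hjk, hj.snd, hk.snd, by_contra fun h => (h3 i j h).not_ge hj',
      by_contra fun h => (h3 i k h).not_ge hk'⟩

theorem selF_eq_zero {zbar : PDSpace n l m p} (hF : P.F zbar = 0) {s : Selection l p}
    (hs : P.IsConsistent zbar s) : P.selF s zbar = 0 := by
  obtain ⟨h1, -, h3, -⟩ := F_eq_zero_iff_blocks.1 hF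
  have hdot : ∀ (c w : Fin 4 → ℝ) (j : Fin 4), (c = Pi.single j 1 ∨ c = -Pi.single j 1) →
      w j = 0 → c ⬝ᵥ w = 0 := by
    rintro c w j (rfl | rfl) hw <;> simp [hw]
  ext j
  rcases j with j | j | j | j | j
  · exact congrArg (fun v : EuclideanSpace ℝ (Fin n) => v j) h1
  · change (if s.1 j then -P.g j zbar.x else zbar.lam j) = 0
    rcases hs.1 j with ⟨h, h'⟩ | ⟨h, h'⟩ <;> simp [h, h']
  · exact h3 j
  · obtain ⟨i, k, -, hi, -, hi', -⟩ := hs.2 j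
    exact hdot _ _ i hi hi'
  · obtain ⟨i, k, -, -, hk, -, hk'⟩ := hs.2 j
    exact hdot _ _ k hk hk'

/-! ### Regularity under MPCC-LICQ and MPCC-SSOC -/

/-- MPCC-LICQ in terms of coefficient vectors supported on the active indices. -/
theorem LICQ.eq_zero {x : EuclideanSpace ℝ (Fin n)} (hL : P.LICQ x) {a : Fin l → ℝ}
    {b : Fin m → ℝ} {c e : Fin p → ℝ} (ha : ∀ i ∉ P.activeG x, a i = 0)
    (hc : ∀ i ∉ P.indexZeroPos x ∪ P.biactive x, c i = 0)
    (he : ∀ i ∉ P.indexPosZero x ∪ P.biactive x, e i = 0)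
    (hsum : ∑ j, a j • gradient (P.g j) x + ∑ j, b j • gradient (P.h j) x
      + ∑ j, c j • gradient (P.G j) x + ∑ j, e j • gradient (P.H j) x = 0) :
    (∀ i, a i = 0) ∧ (∀ i, b i = 0) ∧ (∀ i, c i = 0) ∧ ∀ i, e i = 0 := by
  classical
  have i1 : Fintype (P.activeG x) := Fintype.ofFinite _
  have i2 : Fintype (P.indexZeroPos x ∪ P.biactive x : Set (Fin p)) := Fintype.ofFinite _
  have i3 : Fintype (P.indexPosZero x ∪ P.biactive x : Set (Fin p)) := Fintype.ofFinite _
  have h := Fintype.linearIndependent_iff.1 hL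
    (Sum.elim (fun i => a i) (Sum.elim b (Sum.elim (fun i => c i) (fun i => e i))))
  have h0 := h (by
    simp only [Fintype.sum_sum_type, Sum.elim_inl, Sum.elim_inr]
    rw [sum_subtype_of_eq_zero (P.activeG x) (u := fun i => a i • gradient (P.g i) x)
        (fun i hi => by rw [ha i hi, zero_smul]),
      sum_subtype_of_eq_zero (P.indexZeroPos x ∪ P.biactive x)
        (u := fun i => c i • gradient (P.G i) x) (fun i hi => by rw [hc i hi, zero_smul]),
      sum_subtype_of_eq_zero (P.indexPosZero x ∪ P.biactive x)
        (u := fun i => e i • gradient (P.H i) x) (fun i hi => by rw [he i hi, zero_smul]),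
      ← hsum]
    abel)
  refine ⟨fun i => ?_, fun i => h0 (Sum.inr (Sum.inl i)), fun i => ?_, fun i => ?_⟩
  · by_cases hi : i ∈ P.activeG x
    · exact h0 (Sum.inl ⟨i, hi⟩)
    · exact ha i hi
  · by_cases hi : i ∈ P.indexZeroPos x ∪ P.biactive x
    · exact h0 (Sum.inr (Sum.inr (Sum.inl ⟨i, hi⟩)))
    · exact hc i hi
  · by_cases hi : i ∈ P.indexPosZero x ∪ P.biactive x
    · exact h0 (Sum.inr (Sum.inr (Sum.inr ⟨i, hi⟩)))
    · exact he i hi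

/-- The linearized equations of a consistent selection for one complementarity pair: they are
indexed by the pairs `{a, b}`, `{a, ν}` or `{b, μ}`. -/
theorem IsConsistent.compl_cases {zbar : PDSpace n l m p} {s : Selection l p}
    (hs : P.IsConsistent zbar s) {d : PDSpace n l m p} {i : Fin p}
    (h1 : s.2.1 i ⬝ᵥ P.complDeriv zbar d i = 0) (h2 : s.2.2 i ⬝ᵥ P.complDeriv zbar d i = 0) :
    ((P.G i zbar.x = 0 ∧ P.H i zbar.x = 0) ∧
      inner ℝ (gradient (P.G i) zbar.x) d.x = 0 ∧ inner ℝ (gradient (P.H i) zbar.x) d.x = 0) ∨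
    ((P.G i zbar.x = 0 ∧ zbar.nu i = 0) ∧
      inner ℝ (gradient (P.G i) zbar.x) d.x = 0 ∧ d.nu i = 0) ∨
    ((P.H i zbar.x = 0 ∧ zbar.mu i = 0) ∧
      inner ℝ (gradient (P.H i) zbar.x) d.x = 0 ∧ d.mu i = 0) := by
  obtain ⟨j, k, hjk, hj, hk, hj0, hk0⟩ := hs.2 i
  have hdot : ∀ (c w : Fin 4 → ℝ) (j : Fin 4), (c = Pi.single j 1 ∨ c = -Pi.single j 1) →
      c ⬝ᵥ w = 0 → w j = 0 := by
    rintro c w j (rfl | rfl) hw <;> simpa using hw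
  have hj' := hdot _ _ j hj h1
  have hk' := hdot _ _ k hk h2
  rcases hjk with ⟨rfl, rfl | rfl⟩ | ⟨rfl, rfl | rfl⟩ | ⟨rfl, rfl⟩ | ⟨rfl, rfl⟩
  · exact Or.inl ⟨⟨hj0, hk0⟩, hj', hk'⟩
  · exact Or.inr (Or.inl ⟨⟨hj0, hk0⟩, hj', hk'⟩)
  · exact Or.inl ⟨⟨hk0, hj0⟩, hk', hj'⟩
  · exact Or.inr (Or.inr ⟨⟨hj0, hk0⟩, hj', hk'⟩)
  · exact Or.inr (Or.inr ⟨⟨hk0, hj0⟩, hk', hj'⟩)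
  · exact Or.inr (Or.inl ⟨⟨hk0, hj0⟩, hk', hj'⟩)

/-- The linearization of a consistent selection is injective. The selected equations put the
`x`-part of a kernel element into the set on which the second-order condition is posed and make
all products of multiplier increments with linearized constraints vanish; so the `x`-part is zero,
and the multiplier part vanishes by linear independence. -/
theorem eq_zero_of_fderiv_selF_eq_zero (hP : P.IsC2) {zbar : PDSpace n l m p}
    (hM : P.IsMStationaryTuple zbar) (hL : P.LICQ zbar.x) (hS : P.SSOC zbar) {s : Selection l p}
    (hs : P.IsConsistent zbar s) {d : PDSpace n l m p} (hd : fderiv ℝ (P.selF s) zbar d = 0) :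
    d = 0 := by
  rw [fderiv_selF_apply hP] at hd
  have hj := fun j => congrArg (fun v : PDSpace n l m p => v j) hd
  have h0 : P.gradLagrangianDeriv zbar d = 0 := by
    ext i; exact hj (Sum.inl i)
  rw [gradLagrangianDeriv_apply hP] at h0
  have hg : ∀ i, (P.g i zbar.x = 0 ∧ inner ℝ (gradient (P.g i) zbar.x) d.x = 0) ∨
      (zbar.lam i = 0 ∧ d.lam i = 0) := by
    intro i
    have h : (if s.1 i then -inner ℝ (gradient (P.g i) zbar.x) d.x else d.lam i) = 0 :=
      hj (Sum.inr (Sum.inl i))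
    rcases hs.1 i with ⟨k, k'⟩ | ⟨k, k'⟩
    · rw [if_pos k] at h
      exact Or.inl ⟨k', neg_eq_zero.1 h⟩
    · rw [if_neg (by simp [k])] at h
      exact Or.inr ⟨k', h⟩
  have hh : ∀ i, inner ℝ (gradient (P.h i) zbar.x) d.x = 0 := fun i =>
    hj (Sum.inr (Sum.inr (Sum.inl i)))
  have hc := fun i => hs.compl_cases (d := d) (i := i)
    (hj (Sum.inr (Sum.inr (Sum.inr (Sum.inl i))))) (hj (Sum.inr (Sum.inr (Sum.inr (Sum.inr i)))))
  have hx : d.x = 0 := by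
    by_contra hne
    have hset : P.InSSOCSet zbar d.x := by
      refine ⟨fun i _ hi' => ?_, hh, fun i hi => ?_, fun i hi => ?_, fun i _ _ _ => ?_⟩
      · rcases hg i with h | h
        · exact h.2
        · exact absurd h.1 hi'.ne'
      · rcases hc i with h | h | h
        · exact h.2.1
        · exact h.2.1
        · rcases hi with hi | hi
          · exact absurd h.1.1 hi.2.ne'
          · exact absurd h.1.2 hi.2
      · rcases hc i with h | h | h
        · exact h.2.2
        · rcases hi with hi | hi
          · exact absurd h.1.1 hi.1.ne'
          · exact absurd h.1.2 hi.2
        · exact h.2.1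
      · rcases hc i with h | h | h
        · rw [h.2.1, zero_mul]
        · rw [h.2.1, zero_mul]
        · rw [h.2.1, mul_zero]
    have hpos := hS d.x hset hne
    have hin := congrArg (fun v => inner ℝ d.x v) h0
    simp only [inner_add_right, inner_sum, inner_smul_right, inner_zero_right] at hin
    have s1 : ∑ j, d.lam j * inner ℝ d.x (gradient (P.g j) zbar.x) = 0 :=
      Finset.sum_eq_zero fun i _ => by
        rcases hg i with h | h
        · rw [real_inner_comm, h.2, mul_zero]
        · rw [h.2, zero_mul]
    have s2 : ∑ j, d.eta j * inner ℝ d.x (gradient (P.h j) zbar.x) = 0 :=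
      Finset.sum_eq_zero fun i _ => by rw [real_inner_comm, hh, mul_zero]
    have s3 : ∑ j, d.mu j * inner ℝ d.x (gradient (P.G j) zbar.x) = 0 :=
      Finset.sum_eq_zero fun i _ => by
        rcases hc i with h | h | h
        · rw [real_inner_comm, h.2.1, mul_zero]
        · rw [real_inner_comm, h.2.1, mul_zero]
        · rw [h.2.2, zero_mul]
    have s4 : ∑ j, d.nu j * inner ℝ d.x (gradient (P.H j) zbar.x) = 0 :=
      Finset.sum_eq_zero fun i _ => by
        rcases hc i with h | h | h
        · rw [real_inner_comm, h.2.2, mul_zero]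
        · rw [h.2.2, zero_mul]
        · rw [real_inner_comm, h.2.1, mul_zero]
    rw [s1, s2, s3, s4] at hin
    linarith
  rw [hx, map_zero, zero_add] at h0
  have hG := hM.feasible.G_nonneg
  have hH := hM.feasible.H_nonneg
  obtain ⟨ha, hb, hc', he⟩ := hL.eq_zero (a := d.lam) (b := d.eta) (c := d.mu) (e := d.nu)
    (fun i hi => by
      rcases hg i with h | h
      · exact absurd h.1 hi
      · exact h.2)
    (fun i hi => by
      have hmem : P.G i zbar.x = 0 → i ∈ P.indexZeroPos zbar.x ∪ P.biactive zbar.x := fun h =>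
        (hH i).eq_or_lt.elim (fun k => Or.inr ⟨h, k.symm⟩) fun k => Or.inl ⟨h, k⟩
      rcases hc i with h | h | h
      · exact absurd (hmem h.1.1) hi
      · exact absurd (hmem h.1.1) hi
      · exact h.2.2)
    (fun i hi => by
      have hmem : P.H i zbar.x = 0 → i ∈ P.indexPosZero zbar.x ∪ P.biactive zbar.x := fun h =>
        (hG i).eq_or_lt.elim (fun k => Or.inr ⟨k.symm, h⟩) fun k => Or.inl ⟨k, h⟩
      rcases hc i with h | h | h
      · exact absurd (hmem h.1.2) hi
      · exact h.2.2
      · exact absurd (hmem h.1.1) hi) h0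
  exact eq_zero_of_blocks hx ha hb hc' he

/-- The Newton derivatives are uniformly invertible near a regular M-stationary tuple. -/
theorem exists_norm_le_DF (hP : P.IsC2) {zbar : PDSpace n l m p}
    (hM : P.IsMStationaryTuple zbar) (hL : P.LICQ zbar.x) (hS : P.SSOC zbar) :
    ∃ C, 0 < C ∧ ∀ᶠ z in 𝓝 zbar, ∀ d, ‖d‖ ≤ C * ‖P.DF z d‖ := by
  obtain ⟨C, hC, h⟩ := exists_norm_le_of_injective
    (S := {s ∈ unitSelections l p | P.IsConsistent zbar s})
    ((finite_unitSelections l p).subset fun s hs => hs.1)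
    (A := fun s => fderiv ℝ (P.selF s)) (x := zbar)
    (fun s _ => ((contDiff_selF hP s).continuous_fderiv one_ne_zero).continuousAt)
    (fun s hs d hd => eq_zero_of_fderiv_selF_eq_zero hP hM hL hS hs.2 hd)
  refine ⟨C, hC, ?_⟩
  filter_upwards [h, eventually_isConsistent_sel hP (isMStationaryTuple_iff.1 hM)] with z hz hs d
  rw [DF_apply hP]
  exact hz _ ⟨sel_mem_unitSelections z, hs⟩ d

/-! ### Newton differentiability -/

/-- The active selection varies with `z`, so its linearization error is bounded by the sum over all
selections. -/
theorem norm_newton_remainder_le (hP : P.IsC2) {zbar : PDSpace n l m p} (hF : P.F zbar = 0) :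
    ∀ᶠ z in 𝓝 zbar, ‖P.F z - P.DF z (z - zbar)‖ ≤ ∑ s ∈ (finite_unitSelections l p).toFinset,
      ‖P.selF s z - P.selF s zbar - fderiv ℝ (P.selF s) z (z - zbar)‖ := by
  filter_upwards [eventually_isConsistent_sel hP hF] with z hz
  rw [DF_apply hP, ← selF_sel, ← sub_zero (P.selF (P.sel z) z), ← selF_eq_zero hF hz]
  exact Finset.single_le_sum
    (f := fun s => ‖P.selF s z - P.selF s zbar - fderiv ℝ (P.selF s) z (z - zbar)‖)
    (fun _ _ => norm_nonneg _) ((Set.Finite.mem_toFinset _).2 (sel_mem_unitSelections z))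

theorem isLittleO_newton_remainder (hP : P.IsC2) {zbar : PDSpace n l m p} (hF : P.F zbar = 0) :
    (fun z => P.F z - P.DF z (z - zbar)) =o[𝓝 zbar] fun z => z - zbar := by
  have h := IsLittleO.sum (s := (finite_unitSelections l p).toFinset) fun s _ =>
    ((contDiff_selF hP s).isLittleO_linearization zbar).norm_left
  refine (IsBigO.of_bound 1 ?_).trans_isLittleO h
  filter_upwards [norm_newton_remainder_le hP hF] with z hz
  rw [one_mul]
  simpa using hz.trans (le_abs_self _)

theorem locallyLipschitz_fderiv_gradient {u : EuclideanSpace ℝ (Fin n) → ℝ}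
    (hu : ContDiff ℝ 2 u) (h : LocallyLipschitz (fderiv ℝ (fderiv ℝ u))) :
    LocallyLipschitz (fderiv ℝ (gradient u)) := by
  -- over `ℝ`, the conjugate-linear Riesz isomorphism is linear
  let J : (EuclideanSpace ℝ (Fin n) →L[ℝ] ℝ) →L[ℝ] EuclideanSpace ℝ (Fin n) :=
    LinearMap.toContinuousLinearMap
      { toFun := (InnerProductSpace.toDual ℝ (EuclideanSpace ℝ (Fin n))).symm
        map_add' := map_add _
        map_smul' := fun c v => by simp }
  have e : fderiv ℝ (gradient u) = fun x => ContinuousLinearMap.compL ℝ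
      (EuclideanSpace ℝ (Fin n)) (EuclideanSpace ℝ (Fin n) →L[ℝ] ℝ) (EuclideanSpace ℝ (Fin n))
      J (fderiv ℝ (fderiv ℝ u) x) := by
    funext x
    have hd : HasFDerivAt (fderiv ℝ u) (fderiv ℝ (fderiv ℝ u) x) x :=
      ((hu.fderiv_right (m := 1) (by norm_num)).differentiable one_ne_zero x).hasFDerivAt
    exact (J.hasFDerivAt.comp x hd).fderiv
  rw [e]
  exact (ContinuousLinearMap.lipschitz _).locallyLipschitz.comp h

theorem locallyLipschitz_sumGradDeriv {k : ℕ} (c : Fin k → PDSpace n l m p →L[ℝ] ℝ)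
    {u : Fin k → EuclideanSpace ℝ (Fin n) → ℝ} (hu : ∀ i, ContDiff ℝ 2 (u i))
    (hL : ∀ i, LocallyLipschitz (fderiv ℝ (fderiv ℝ (u i)))) :
    LocallyLipschitz (sumGradDeriv c u) := by
  refine LocallyLipschitz.fun_sum _ fun j _ => LocallyLipschitz.add ?_ ?_
  · have hx : LocallyLipschitz (xCLM (n := n) (l := l) (m := m) (p := p)) :=
      (ContinuousLinearMap.lipschitz _).locallyLipschitz
    have h1 := (locallyLipschitz_fderiv_gradient (hu j) (hL j)).comp hx
    have h2 := (((ContinuousLinearMap.compL ℝ (PDSpace n l m p) (EuclideanSpace ℝ (Fin n))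
      (EuclideanSpace ℝ (Fin n))).flip xCLM).lipschitz).locallyLipschitz.comp h1
    exact (contDiff_smul (𝕜 := ℝ) (n := 1)).locallyLipschitz.comp
      ((c j).lipschitz.locallyLipschitz.prodMk h2)
  · exact (ContinuousLinearMap.smulRightL ℝ (PDSpace n l m p) (EuclideanSpace ℝ (Fin n))
      (c j)).lipschitz.locallyLipschitz.comp
      ((contDiff_gradient (hu j)).comp
        (xCLM (n := n) (l := l) (m := m) (p := p)).contDiff).locallyLipschitz

theorem locallyLipschitz_gradLagrangianDeriv (hP : P.IsC2)
    (hL : P.HasLocallyLipschitzSecondDerivatives) : LocallyLipschitz P.gradLagrangianDeriv := by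
  have hx : LocallyLipschitz (xCLM (n := n) (l := l) (m := m) (p := p)) :=
    (ContinuousLinearMap.lipschitz _).locallyLipschitz
  have h1 := (((ContinuousLinearMap.compL ℝ (PDSpace n l m p) (EuclideanSpace ℝ (Fin n))
    (EuclideanSpace ℝ (Fin n))).flip xCLM).lipschitz).locallyLipschitz.comp
    ((locallyLipschitz_fderiv_gradient hP.f hL.f).comp hx)
  exact (((h1.add (locallyLipschitz_sumGradDeriv lamCLM hP.g hL.g)).add
    (locallyLipschitz_sumGradDeriv etaCLM hP.h hL.h)).add
    (locallyLipschitz_sumGradDeriv muCLM hP.G hL.G)).add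
    (locallyLipschitz_sumGradDeriv nuCLM hP.H hL.H)

theorem isBigO_selF_linearization (hP : P.IsC2) (hL : P.HasLocallyLipschitzSecondDerivatives)
    (s : Selection l p) (zbar : PDSpace n l m p) :
    (fun z => P.selF s z - P.selF s zbar - fderiv ℝ (P.selF s) z (z - zbar))
      =O[𝓝 zbar] fun z => ‖z - zbar‖ ^ 2 := by
  refine isBigO_euclidean fun j => ?_
  rcases j with j | j
  · have hd := hasFDerivAt_gradLagrangian hP
    have h := LocallyLipschitz.isBigO_linearization (fun z => (hd z).differentiableAt)
      ((funext fun z => (hd z).fderiv : fderiv ℝ P.gradLagrangian = _) ▸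
        locallyLipschitz_gradLagrangianDeriv hP hL) zbar
    refine (IsBigO.of_bound 1 (Eventually.of_forall fun z => ?_)).trans h
    rw [one_mul, (hd z).fderiv, fderiv_selF_apply hP]
    exact EuclideanSpace.abs_apply_le
      (P.gradLagrangian z - P.gradLagrangian zbar - P.gradLagrangianDeriv z (z - zbar)) j
  · have hc := contDiff_selF_apply hP s j
    have h := LocallyLipschitz.isBigO_linearization (hc.differentiable two_ne_zero)
      (hc.fderiv_right (m := 1) (by norm_num)).locallyLipschitz zbar
    refine h.congr_left fun z => ?_
    have hz : HasFDerivAt (fun z => P.selF s z (Sum.inr j))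
        ((EuclideanSpace.proj (Sum.inr j)).comp (fderiv ℝ (P.selF s) z)) z :=
      (EuclideanSpace.proj (Sum.inr j) : PDSpace n l m p →L[ℝ] ℝ).hasFDerivAt.comp z
        ((contDiff_selF hP s).differentiable one_ne_zero z).hasFDerivAt
    rw [hz.fderiv]
    rfl

theorem isBigO_newton_remainder (hP : P.IsC2) (hL : P.HasLocallyLipschitzSecondDerivatives)
    {zbar : PDSpace n l m p} (hF : P.F zbar = 0) :
    (fun z => P.F z - P.DF z (z - zbar)) =O[𝓝 zbar] fun z => ‖z - zbar‖ ^ 2 := by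
  have h := IsBigO.sum (s := (finite_unitSelections l p).toFinset) fun s _ =>
    (isBigO_selF_linearization hP hL s zbar).norm_left
  refine (IsBigO.of_bound 1 ?_).trans h
  filter_upwards [norm_newton_remainder_le hP hF] with z hz
  rw [one_mul]
  simpa using hz.trans (le_abs_self _)

end MPCC

/-! ### Armijo steps along gradient-related directions -/

theorem gradient_eq_zero_of_forall_le {E : Type*} [NormedAddCommGroup E] [InnerProductSpace ℝ E]
    [CompleteSpace E] {Φ : E → ℝ} {x : E} (h : ∀ y, Φ x ≤ Φ y) : gradient Φ x = 0 := by
  rw [gradient, IsLocalMin.fderiv_eq_zero (Eventually.of_forall h), map_zero]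

/-- Near a nonstationary point, Armijo steps along directions that satisfy the angle condition and
are bounded away from zero decrease the function by a fixed amount. -/
theorem exists_armijo_decrease {E : Type*} [NormedAddCommGroup E] [InnerProductSpace ℝ E]
    [CompleteSpace E] {Φ : E → ℝ} (hΦ : ContDiff ℝ 1 Φ) {x : E} (hx : gradient Φ x ≠ 0)
    {ρ σ β c : ℝ} (hρ : 0 < ρ) (hσ : σ ∈ Set.Ioo (0 : ℝ) 1) (hβ : 0 < β) (hc : 0 < c) :
    ∃ δ, 0 < δ ∧ ∀ᶠ z in 𝓝 x, ∀ (d : E) (i : ℕ), c ≤ ‖d‖ →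
      inner ℝ (gradient Φ z) d ≤ -ρ * ‖d‖ * ‖gradient Φ z‖ →
      IsLeast {j : ℕ | Φ (z + β ^ j • d) ≤ Φ z + σ * β ^ j * inner ℝ (gradient Φ z) d} i →
      Φ (z + β ^ i • d) ≤ Φ z - δ := by
  obtain ⟨hσ0, hσ1⟩ := hσ
  have hσ1' : 0 < 1 - σ := by linarith
  have hnorm : ∀ z, ‖gradient Φ z‖ = ‖fderiv ℝ Φ z‖ := fun z => LinearIsometryEquiv.norm_map _ _
  have hcont : Continuous (fderiv ℝ Φ) := hΦ.continuous_fderiv one_ne_zero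
  set γ : ℝ := ‖gradient Φ x‖ / 2 with hγdef
  have hγ : 0 < γ := by have := norm_pos_iff.2 hx; positivity
  set ε : ℝ := (1 - σ) * ρ * γ / 2 with hεdef
  have hε : 0 < ε := by positivity
  have e1 : ∀ᶠ y in 𝓝 x, ‖fderiv ℝ Φ y - fderiv ℝ Φ x‖ < ε := by
    simpa only [dist_eq_norm] using Metric.continuousAt_iff'.1 (hcont.continuousAt (x := x)) ε hε
  have e2 : ∀ᶠ y in 𝓝 x, γ < ‖gradient Φ y‖ := by
    simp only [hnorm]
    refine continuousAt_const.eventually_lt hcont.norm.continuousAt ?_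
    rw [← hnorm, hγdef]
    linarith [norm_pos_iff.2 hx]
  obtain ⟨r, hr, hball⟩ := Metric.eventually_nhds_iff_ball.1 (e1.and e2)
  refine ⟨σ * ρ * γ * min c (β * (r / 2)), by positivity, ?_⟩
  filter_upwards [Metric.ball_mem_nhds x (half_pos hr)] with z hz d i hcd hangle hi
  rw [Metric.mem_ball, dist_eq_norm] at hz
  have hzr : z ∈ Metric.ball x r := by
    rw [Metric.mem_ball, dist_eq_norm]; linarith
  have hgz := (hball z hzr).2
  have hangle' : inner ℝ (gradient Φ z) d ≤ -(ρ * γ * ‖d‖) := by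
    have : ρ * ‖d‖ * γ ≤ ρ * ‖d‖ * ‖gradient Φ z‖ := by gcongr
    nlinarith
  -- the Armijo condition holds as soon as the step stays within the ball
  have key : ∀ t : ℝ, 0 ≤ t → t * ‖d‖ < r / 2 →
      Φ (z + t • d) ≤ Φ z + σ * t * inner ℝ (gradient Φ z) d := by
    intro t ht htd
    have hmem : z + t • d ∈ Metric.ball x r := by
      rw [Metric.mem_ball, dist_eq_norm, add_sub_right_comm]
      refine (norm_add_le _ _).trans_lt ?_
      rw [norm_smul, Real.norm_of_nonneg ht]
      linarith
    have hb : ∀ w ∈ Metric.ball x r, ‖fderiv ℝ Φ w - fderiv ℝ Φ z‖ ≤ (1 - σ) * ρ * γ := by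
      intro w hw
      have h1 := (hball w hw).1
      have h2 := (hball z hzr).1
      rw [norm_sub_rev] at h2
      have := norm_add_le (fderiv ℝ Φ w - fderiv ℝ Φ x) (fderiv ℝ Φ x - fderiv ℝ Φ z)
      rw [sub_add_sub_cancel] at this
      linarith
    have h := (convex_ball x r).norm_image_sub_le_of_norm_fderiv_le'
      (fun w _ => hΦ.differentiable one_ne_zero w) hb hzr hmem
    rw [add_sub_cancel_left, map_smul, norm_smul, Real.norm_of_nonneg ht,
      ← inner_gradient_left, smul_eq_mul] at h
    have h' := (le_abs_self _).trans h
    have h3 : t * ((1 - σ) * inner ℝ (gradient Φ z) d)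
        ≤ t * ((1 - σ) * -(ρ * γ * ‖d‖)) := by gcongr
    linarith
  have hstep : min c (β * (r / 2)) ≤ β ^ i * ‖d‖ := by
    cases i with
    | zero => simpa using Or.inl hcd
    | succ j =>
      refine (min_le_right _ _).trans ?_
      rw [pow_succ', mul_assoc]
      refine mul_le_mul_of_nonneg_left (le_of_not_gt fun hlt => ?_) hβ.le
      have := hi.2 (key (β ^ j) (by positivity) hlt)
      omega
  have h1 : Φ (z + β ^ i • d) ≤ Φ z + σ * β ^ i * inner ℝ (gradient Φ z) d := hi.1
  have h2 : σ * β ^ i * inner ℝ (gradient Φ z) d ≤ σ * β ^ i * -(ρ * γ * ‖d‖) := by gcongr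
  have h3 : σ * ρ * γ * min c (β * (r / 2)) ≤ σ * ρ * γ * (β ^ i * ‖d‖) := by gcongr
  linarith

namespace MPCC

variable {n l m p : ℕ} {P : MPCC n l m p}

/-! ### Descent properties of the globalized method -/

theorem searchDirection_angle {ρ : ℝ} (hρ : ρ ∈ Set.Ioo (0 : ℝ) 1) (z : PDSpace n l m p)
    (o : Option (PDSpace n l m p)) :
    inner ℝ (gradient P.merit z) (P.searchDirection ρ z o)
      ≤ -ρ * ‖P.searchDirection ρ z o‖ * ‖gradient P.merit z‖ := by
  have h : inner ℝ (gradient P.merit z) (-gradient P.merit z)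
      ≤ -ρ * ‖-gradient P.merit z‖ * ‖gradient P.merit z‖ := by
    rw [inner_neg_right, norm_neg, real_inner_self_eq_norm_sq]
    nlinarith [sq_nonneg ‖gradient P.merit z‖, hρ.2]
  cases o with
  | none => exact h
  | some d =>
    unfold searchDirection
    dsimp only
    split_ifs with hd
    · exact h
    · exact not_lt.1 hd

theorem IsStep.merit_le {q ρ σ β : ℝ} (hq : q ≤ 1) (hρ : ρ ∈ Set.Ioo (0 : ℝ) 1) (hσ : 0 < σ)
    (hβ : 0 < β) {z z' : PDSpace n l m p} {o : Option (PDSpace n l m p)}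
    (h : P.IsStep q ρ σ β z o z') (hz : P.merit z ≠ 0) : P.merit z' ≤ P.merit z := by
  have hpos : 0 < P.merit z := (merit_nonneg z).lt_of_ne' hz
  rcases h.2 with ⟨⟨d, rfl, hr⟩, d', hd', rfl⟩ | ⟨-, i, hi, rfl⟩
  · obtain rfl := Option.some.inj hd'
    rw [div_le_iff₀ hpos] at hr
    nlinarith
  · refine hi.1.trans ?_
    have h1 := searchDirection_angle (P := P) hρ z o
    have h2 : 0 ≤ ρ * ‖P.searchDirection ρ z o‖ * ‖gradient P.merit z‖ := by
      have := hρ.1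
      positivity
    have h3 : 0 ≤ σ * β ^ i := by positivity
    nlinarith

theorem IsStep.merit_le_mul {q ρ σ β : ℝ} {z z' : PDSpace n l m p}
    {o : Option (PDSpace n l m p)} (h : P.IsStep q ρ σ β z o z') (hr : P.RatioTest q z o)
    (hz : P.merit z ≠ 0) : P.merit z' ≤ q * P.merit z := by
  have hpos : 0 < P.merit z := (merit_nonneg z).lt_of_ne' hz
  rcases h.2 with ⟨⟨d, rfl, hle⟩, d', hd', rfl⟩ | ⟨hn, -⟩
  · obtain rfl := Option.some.inj hd'
    rwa [div_le_iff₀ hpos] at hle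
  · exact absurd hr hn

theorem IsRun.F_ne_zero {q τ ρ σ β : ℝ} (hτ : 0 ≤ τ) {z : ℕ → PDSpace n l m p}
    {o : ℕ → Option (PDSpace n l m p)} (hz : P.IsRun q τ ρ σ β z o) (k : ℕ) : P.F (z k) ≠ 0 :=
  norm_pos_iff.1 (hτ.trans_lt (hz k).1)

theorem IsRun.exists_tendsto_merit {q τ ρ σ β : ℝ} (hq : q ≤ 1) (hτ : 0 ≤ τ)
    (hρ : ρ ∈ Set.Ioo (0 : ℝ) 1) (hσ : 0 < σ) (hβ : 0 < β) {z : ℕ → PDSpace n l m p}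
    {o : ℕ → Option (PDSpace n l m p)} (hz : P.IsRun q τ ρ σ β z o) :
    ∃ L, 0 ≤ L ∧ Tendsto (fun k => P.merit (z k)) atTop (𝓝 L) := by
  have hanti : Antitone fun k => P.merit (z k) := antitone_nat_of_succ_le fun k =>
    (hz k).2.merit_le hq hρ hσ hβ (fun h => hz.F_ne_zero hτ k (merit_eq_zero_iff_F.1 h))
  exact ⟨_, le_ciInf fun k => merit_nonneg _,
    tendsto_atTop_ciInf hanti ⟨0, by rintro _ ⟨k, rfl⟩; exact merit_nonneg _⟩⟩

theorem IsRun.tendsto_merit_zero {q τ ρ σ β : ℝ} (hq : q < 1) (hτ : 0 ≤ τ)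
    (hρ : ρ ∈ Set.Ioo (0 : ℝ) 1) (hσ : 0 < σ) (hβ : 0 < β) {z : ℕ → PDSpace n l m p}
    {o : ℕ → Option (PDSpace n l m p)} (hz : P.IsRun q τ ρ σ β z o)
    (hr : ∃ᶠ k in atTop, P.RatioTest q (z k) (o k)) :
    Tendsto (fun k => P.merit (z k)) atTop (𝓝 0) := by
  obtain ⟨L, hL, hlim⟩ := hz.exists_tendsto_merit hq.le hτ hρ hσ hβ
  have hle : L ≤ q * L := by
    by_contra! hlt
    have hev := (hlim.const_mul q).eventually_lt (hlim.comp (tendsto_add_atTop_nat 1)) hlt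
    obtain ⟨k, hk, hk'⟩ := (hr.and_eventually hev).exists
    exact hk'.not_ge ((hz k).2.merit_le_mul hk
      fun h => hz.F_ne_zero hτ k (merit_eq_zero_iff_F.1 h))
  have : L = 0 := by nlinarith
  rwa [this] at hlim

theorem merit_eq_zero_of_mapClusterPt (hP : P.IsC2) {z : ℕ → PDSpace n l m p}
    {zbar : PDSpace n l m p} (h : MapClusterPt zbar atTop z)
    (hlim : Tendsto (fun k => P.merit (z k)) atTop (𝓝 0)) : P.merit zbar = 0 := by
  by_contra hne
  have hpos : 0 < P.merit zbar := (merit_nonneg zbar).lt_of_ne' hne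
  have h1 := h.frequently ((contDiff_merit hP).continuous.continuousAt.eventually
    (lt_mem_nhds (half_lt_self hpos)))
  obtain ⟨k, hk, hk'⟩ := (h1.and_eventually (hlim.eventually (gt_mem_nhds (half_pos hpos)))).exists
  exact lt_asymm hk hk'

/-- Near a point that is not M-stationary, Newton directions are bounded away from zero. -/
theorem exists_le_norm_newton (hP : P.IsC2) {zbar : PDSpace n l m p} (hz : P.merit zbar ≠ 0) :
    ∃ c, 0 < c ∧ ∀ᶠ z in 𝓝 zbar, ∀ d, P.DF z d = -P.F z → c ≤ ‖d‖ := by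
  obtain ⟨C₁, hC₁, h₁⟩ := P.exists_norm_equiv
  obtain ⟨C₂, hC₂, h₂⟩ := exists_norm_DF_le hP zbar
  have hpos : 0 < P.merit zbar := (merit_nonneg zbar).lt_of_ne' hz
  refine ⟨√(P.merit zbar) / (C₁ * C₂), by positivity, ?_⟩
  have hm := (contDiff_merit hP).continuous.continuousAt.eventually
    (lt_mem_nhds (half_lt_self hpos))
  filter_upwards [h₂, hm] with z hz hzm d hd
  rw [div_le_iff₀ (by positivity)]
  have hF : √(P.merit zbar) ≤ ‖P.FFB z‖ := by
    refine Real.sqrt_le_iff.2 ⟨norm_nonneg _, ?_⟩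
    have : P.merit z = 1 / 2 * ‖P.FFB z‖ ^ 2 := rfl
    linarith
  have h3 : ‖P.F z‖ ≤ C₂ * ‖d‖ := by
    rw [← norm_neg, ← hd]; exact hz d
  calc _ ≤ _ := hF
    _ ≤ C₁ * ‖P.F z‖ := (h₁ z).2
    _ ≤ C₁ * (C₂ * ‖d‖) := by gcongr
    _ = _ := by ring

/-- Accumulation points are stationary for the merit function. If the ratio test is passed
infinitely often, the merit function vanishes there; otherwise, near a nonstationary accumulation
point, infinitely many line-search steps would decrease the merit function by a fixed amount. -/
theorem IsRun.gradient_merit_eq_zero (hP : P.IsC2) {q τ ρ σ β : ℝ} (hq : q < 1) (hτ : 0 ≤ τ)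
    (hρ : ρ ∈ Set.Ioo (0 : ℝ) 1) (hσ : σ ∈ Set.Ioo (0 : ℝ) 1) (hβ : 0 < β)
    {z : ℕ → PDSpace n l m p} {o : ℕ → Option (PDSpace n l m p)} (hz : P.IsRun q τ ρ σ β z o)
    {zbar : PDSpace n l m p} (hcl : MapClusterPt zbar atTop z) : gradient P.merit zbar = 0 := by
  by_contra hne
  have hm : P.merit zbar ≠ 0 := fun h =>
    hne (gradient_eq_zero_of_forall_le fun y => h ▸ merit_nonneg y)
  have hr : ∀ᶠ k in atTop, ¬ P.RatioTest q (z k) (o k) := not_frequently.1 fun hr =>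
    hm (merit_eq_zero_of_mapClusterPt hP hcl (hz.tendsto_merit_zero hq hτ hρ hσ.1 hβ hr))
  obtain ⟨c, hc, hnewton⟩ := exists_le_norm_newton hP hm
  have hgc : Continuous fun z => ‖gradient P.merit z‖ := by
    have h : ∀ z, ‖gradient P.merit z‖ = ‖fderiv ℝ P.merit z‖ := fun z =>
      LinearIsometryEquiv.norm_map _ _
    simp only [h]
    exact ((contDiff_merit hP).continuous_fderiv one_ne_zero).norm
  have hgpos := norm_pos_iff.2 hne
  have hgrad := hgc.continuousAt.eventually (lt_mem_nhds (half_lt_self hgpos))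
  obtain ⟨δ, hδ, hdec⟩ := exists_armijo_decrease (contDiff_merit hP) hne hρ.1 hσ hβ
    (lt_min hc (half_pos hgpos))
  obtain ⟨L, -, hlim⟩ := hz.exists_tendsto_merit hq.le hτ hρ hσ.1 hβ
  have hdiff := (hlim.sub (hlim.comp (tendsto_add_atTop_nat 1))).eventually
    (gt_mem_nhds (by rwa [sub_self] : L - L < δ))
  obtain ⟨k, ⟨⟨hk1, hk2⟩, hk3⟩, hk4, hk5⟩ :=
    ((hcl.frequently ((hnewton.and hgrad).and hdec)).and_eventually (hr.and hdiff)).exists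
  obtain ⟨hout, hstep⟩ := (hz k).2
  obtain ⟨-, i, hi, hzk⟩ := hstep.resolve_left fun h => hk4 h.1
  have hlen : min c (‖gradient P.merit zbar‖ / 2) ≤ ‖P.searchDirection ρ (z k) (o k)‖ := by
    have hg : min c (‖gradient P.merit zbar‖ / 2) ≤ ‖-gradient P.merit (z k)‖ := by
      rw [norm_neg]; exact (min_le_right _ _).trans hk2.le
    cases hok : o k with
    | none => exact hg
    | some d =>
      rw [hok] at hout
      unfold searchDirection
      dsimp only
      split_ifs
      · exact hg
      · exact (min_le_left _ _).trans (hk1 d hout)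
  have := hk3 _ i hlen (searchDirection_angle hρ (z k) (o k)) hi
  rw [← hzk] at this
  simp only [Function.comp_apply] at hk5
  linarith

/-! ### Local convergence -/

theorem exists_norm_F_le (hP : P.IsC2) {zbar : PDSpace n l m p} (hF : P.F zbar = 0) :
    ∃ K, 0 < K ∧ ∀ᶠ z in 𝓝 zbar, ‖P.F z‖ ≤ K * ‖z - zbar‖ := by
  obtain ⟨C, hC, h⟩ := exists_norm_DF_le hP zbar
  refine ⟨C + 1, by positivity, ?_⟩
  filter_upwards [h, (isLittleO_newton_remainder hP hF).bound one_pos] with z hz hr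
  have := norm_add_le (P.F z - P.DF z (z - zbar)) (P.DF z (z - zbar))
  rw [sub_add_cancel] at this
  linarith [hz (z - zbar)]

/-- Near a regular M-stationary tuple, the method takes the full Newton step: the Newton system
is uniquely solvable and its solution passes the ratio test, so that the new error is bounded by
the linearization error. -/
theorem eventually_newton_step (hP : P.IsC2) {zbar : PDSpace n l m p}
    (hM : P.IsMStationaryTuple zbar) (hL : P.LICQ zbar.x) (hS : P.SSOC zbar) {q ρ σ β : ℝ}
    (hq : q ∈ Set.Ioo (0 : ℝ) 1) :
    ∃ C, 0 < C ∧ ∀ᶠ z in 𝓝 zbar, ∀ o z', P.F z ≠ 0 → P.IsStep q ρ σ β z o z' →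
      ‖z' - zbar‖ ≤ C * ‖P.F z - P.DF z (z - zbar)‖ := by
  have hF := isMStationaryTuple_iff.1 hM
  obtain ⟨hq0, hq1⟩ := hq
  obtain ⟨C, hC, hinv⟩ := exists_norm_le_DF hP hM hL hS
  obtain ⟨C₁, hC₁, hequiv⟩ := P.exists_norm_equiv
  obtain ⟨K, hK, hFle⟩ := exists_norm_F_le hP hF
  obtain ⟨r, hr, hball⟩ := Metric.eventually_nhds_iff_ball.1 hFle
  -- the first bound halves the error, the second one makes the ratio test succeed
  set ε := min (1 / (2 * C)) (q / (2 * C ^ 2 * C₁ ^ 2 * K)) with hε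
  have hε0 : 0 < ε := by positivity
  refine ⟨C, hC, ?_⟩
  filter_upwards [hinv, (isLittleO_newton_remainder hP hF).bound hε0,
    Metric.ball_mem_nhds zbar hr] with z hz hrem hzr o z' hFz hstep
  set R := P.F z - P.DF z (z - zbar) with hR
  have hinj : Function.Injective (P.DF z) := by
    refine (injective_iff_map_eq_zero _).2 fun d hd => ?_
    have := hz d
    rw [hd, norm_zero, mul_zero] at this
    exact norm_le_zero_iff.1 this
  obtain ⟨d, hd⟩ := (LinearMap.injective_iff_surjective.1 hinj) (-P.F z)
  have hsome : o = some d := by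
    cases o with
    | none => exact absurd ⟨d, hd, fun e he => hinj (he.trans hd.symm)⟩ hstep.1
    | some e =>
      have he : P.DF z e = -P.F z := hstep.1
      rw [hinj (he.trans hd.symm)]
  have herr : ‖z + d - zbar‖ ≤ C * ‖R‖ := by
    have h1 : P.DF z (z + d - zbar) = -R := by
      rw [add_sub_right_comm, map_add, hd, hR]; abel
    have := hz (z + d - zbar)
    rwa [h1, norm_neg] at this
  have hε1 : C * ε ≤ 1 / 2 := by
    calc C * ε ≤ C * (1 / (2 * C)) := by gcongr; exact min_le_left _ _
      _ = 1 / 2 := by field_simp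
  have hε2 : C₁ * K * C * ε ≤ q / (2 * C * C₁) := by
    calc C₁ * K * C * ε ≤ C₁ * K * C * (q / (2 * C ^ 2 * C₁ ^ 2 * K)) := by
          gcongr; exact min_le_right _ _
      _ = q / (2 * C * C₁) := by field_simp
  have hhalf : ‖z + d - zbar‖ ≤ 1 / 2 * ‖z - zbar‖ := by
    calc _ ≤ C * ‖R‖ := herr
      _ ≤ C * (ε * ‖z - zbar‖) := by gcongr
      _ = C * ε * ‖z - zbar‖ := by ring
      _ ≤ _ := by gcongr
  have hnew : ‖P.FFB (z + d)‖ ≤ q / (2 * C * C₁) * ‖z - zbar‖ := by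
    have hmem : z + d ∈ Metric.ball zbar r := by
      rw [Metric.mem_ball, dist_eq_norm] at hzr ⊢
      linarith [norm_nonneg (z - zbar)]
    calc ‖P.FFB (z + d)‖ ≤ C₁ * ‖P.F (z + d)‖ := (hequiv _).2
      _ ≤ C₁ * (K * ‖z + d - zbar‖) := by gcongr; exact hball _ hmem
      _ ≤ C₁ * (K * (C * (ε * ‖z - zbar‖))) := by
        gcongr
        exact herr.trans (by gcongr)
      _ = C₁ * K * C * ε * ‖z - zbar‖ := by ring
      _ ≤ _ := by gcongr
  have hold : 1 / (2 * C * C₁) * ‖z - zbar‖ ≤ ‖P.FFB z‖ := by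
    have h1 : ‖P.DF z (z - zbar)‖ ≤ ‖P.F z‖ + ‖R‖ := by
      have := norm_sub_le (P.F z) R
      rwa [hR, sub_sub_cancel] at this
    have h2 : ‖z - zbar‖ ≤ C * (‖P.F z‖ + ε * ‖z - zbar‖) :=
      (hz _).trans (by gcongr; exact h1.trans (by gcongr))
    have h3 : C * ε * ‖z - zbar‖ ≤ 1 / 2 * ‖z - zbar‖ := by gcongr
    have h4 : C * ‖P.F z‖ ≤ C * (C₁ * ‖P.FFB z‖) := by gcongr; exact (hequiv z).1
    rw [one_div, inv_mul_le_iff₀ (by positivity)]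
    linarith
  have hratio : P.RatioTest q z o := by
    refine ⟨d, hsome, ?_⟩
    have hpos : 0 < P.merit z :=
      (merit_nonneg z).lt_of_ne' fun h => hFz (merit_eq_zero_iff_F.1 h)
    rw [div_le_iff₀ hpos]
    have h1 : ‖P.FFB (z + d)‖ ≤ q * ‖P.FFB z‖ := by
      refine hnew.trans ?_
      calc _ = q * (1 / (2 * C * C₁) * ‖z - zbar‖) := by ring
        _ ≤ _ := by gcongr
    have h2 : ‖P.FFB (z + d)‖ ^ 2 ≤ q * ‖P.FFB z‖ ^ 2 := by
      calc _ ≤ (q * ‖P.FFB z‖) ^ 2 := by gcongr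
        _ = q ^ 2 * ‖P.FFB z‖ ^ 2 := by ring
        _ ≤ _ := by gcongr; nlinarith
    unfold merit
    linarith
  rcases hstep.2 with ⟨-, e, he, rfl⟩ | ⟨hn, -⟩
  · rw [hsome] at he
    rwa [← Option.some.inj he]
  · exact absurd hratio hn

/-- If a regular M-stationary tuple is an accumulation point, the run converges to it, with errors
controlled by the linearization errors: near that point each step at least halves the distance, so
a run that has come close once stays there. -/
theorem IsRun.local_convergence (hP : P.IsC2) {q τ ρ σ β : ℝ} (hq : q ∈ Set.Ioo (0 : ℝ) 1)
    (hτ : 0 ≤ τ) {z : ℕ → PDSpace n l m p} {o : ℕ → Option (PDSpace n l m p)}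
    (hz : P.IsRun q τ ρ σ β z o) {zbar : PDSpace n l m p} (hcl : MapClusterPt zbar atTop z)
    (hM : P.IsMStationaryTuple zbar) (hL : P.LICQ zbar.x) (hS : P.SSOC zbar) :
    Tendsto z atTop (𝓝 zbar) ∧
    (fun k => z (k + 1) - zbar) =O[atTop]
      (fun k => P.F (z k) - P.DF (z k) (z k - zbar)) := by
  have hF := isMStationaryTuple_iff.1 hM
  obtain ⟨C, hC, hstep⟩ := eventually_newton_step (ρ := ρ) (σ := σ) (β := β) hP hM hL hS hq
  have hev := hstep.and ((isLittleO_newton_remainder hP hF).bound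
    (by positivity : 0 < 1 / (2 * C)))
  obtain ⟨r, hr, hball⟩ := Metric.eventually_nhds_iff_ball.1 hev
  obtain ⟨k₀, hk₀⟩ := (hcl.frequently (Metric.ball_mem_nhds zbar hr)).exists
  have hhalf : ∀ k, z k ∈ Metric.ball zbar r → ‖z (k + 1) - zbar‖ ≤ 1 / 2 * ‖z k - zbar‖ := by
    intro k hk
    obtain ⟨h1, h2⟩ := hball _ hk
    calc _ ≤ _ := h1 _ _ (hz.F_ne_zero hτ k) (hz k).2
      _ ≤ C * (1 / (2 * C) * ‖z k - zbar‖) := by gcongr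
      _ = _ := by field_simp
  have hmem : ∀ j, z (k₀ + j) ∈ Metric.ball zbar r ∧ ‖z (k₀ + j) - zbar‖ ≤ (1 / 2) ^ j * r := by
    intro j
    induction j with
    | zero =>
      refine ⟨hk₀, ?_⟩
      simpa using (mem_ball_iff_norm.1 hk₀).le
    | succ j ih =>
      have h := hhalf _ ih.1
      have h1 := ih.1
      rw [Metric.mem_ball, dist_eq_norm] at h1 ⊢
      rw [← add_assoc]
      refine ⟨by linarith [norm_nonneg (z (k₀ + j) - zbar)], ?_⟩
      rw [pow_succ']
      linarith [ih.2]
  have hlim : Tendsto z atTop (𝓝 zbar) := by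
    rw [← tendsto_add_atTop_iff_nat k₀, tendsto_iff_norm_sub_tendsto_zero]
    have hgeom : Tendsto (fun j : ℕ => (1 / 2 : ℝ) ^ j * r) atTop (𝓝 0) := by
      have h := (tendsto_pow_atTop_nhds_zero_of_lt_one (by norm_num : (0 : ℝ) ≤ 1 / 2)
        (by norm_num)).mul_const r
      rwa [zero_mul] at h
    refine squeeze_zero (fun j => norm_nonneg _) (fun j => ?_) hgeom
    rw [add_comm]
    exact (hmem j).2
  exact ⟨hlim, IsBigO.of_bound C ((hlim.eventually hstep).mono fun k hk =>
    hk _ _ (hz.F_ne_zero hτ k) (hz k).2)⟩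

end MPCC

end

theorem mainTheorem3 {n l m p : ℕ} (P : MPCC n l m p) (hP : P.IsC2)
    (q τ ρ σ β : ℝ) (hq : q ∈ Set.Ioo (0 : ℝ) 1) (hτ : τ ∈ Set.Ico (0 : ℝ) 1)
    (hρ : ρ ∈ Set.Ioo (0 : ℝ) 1) (hσ : σ ∈ Set.Ioo (0 : ℝ) 1) (hβ : β ∈ Set.Ioo (0 : ℝ) 1)
    (z : ℕ → PDSpace n l m p) (o : ℕ → Option (PDSpace n l m p))
    (hz : P.IsRun q τ ρ σ β z o) :
    ContDiff ℝ 1 P.merit ∧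
    ((∃ᶠ k in Filter.atTop, P.RatioTest q (z k) (o k)) →
      Filter.Tendsto (fun k => P.merit (z k)) Filter.atTop (nhds 0) ∧
      ∀ zbar, MapClusterPt zbar Filter.atTop z → P.IsMStationaryTuple zbar) ∧
    (∀ zbar, MapClusterPt zbar Filter.atTop z → HasGradientAt P.merit 0 zbar) ∧
    (∀ zbar, MapClusterPt zbar Filter.atTop z →
      P.IsMStationaryTuple zbar → P.LICQ zbar.x → P.SSOC zbar →
      Filter.Tendsto z Filter.atTop (nhds zbar) ∧
      (fun k => z (k + 1) - zbar) =o[Filter.atTop] (fun k => z k - zbar) ∧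
      (P.HasLocallyLipschitzSecondDerivatives →
        (fun k => z (k + 1) - zbar) =O[Filter.atTop] (fun k => ‖z k - zbar‖ ^ 2))) := by
  have hstat : ∀ zbar, MapClusterPt zbar Filter.atTop z → gradient P.merit zbar = 0 :=
    fun zbar hcl => hz.gradient_merit_eq_zero hP hq.2 hτ.1 hρ hσ hβ.1 hcl
  refine ⟨MPCC.contDiff_merit hP, fun hr => ?_, fun zbar hcl => ?_, fun zbar hcl hM hL hS => ?_⟩
  · have hlim := hz.tendsto_merit_zero hq.2 hτ.1 hρ hσ.1 hβ.1 hr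
    exact ⟨hlim, fun zbar hcl => MPCC.isMStationaryTuple_iff.2
      (MPCC.merit_eq_zero_iff_F.1 (MPCC.merit_eq_zero_of_mapClusterPt hP hcl hlim))⟩
  · rw [← hstat zbar hcl]
    exact ((MPCC.contDiff_merit hP).differentiable one_ne_zero zbar).hasGradientAt
  · have hF := MPCC.isMStationaryTuple_iff.1 hM
    obtain ⟨hlim, hO⟩ := hz.local_convergence hP hq hτ.1 hcl hM hL hS
    exact ⟨hlim,
      hO.trans_isLittleO ((MPCC.isLittleO_newton_remainder hP hF).comp_tendsto hlim),
      fun hlip => hO.trans ((MPCC.isBigO_newton_remainder hP hlip hF).comp_tendsto hlim)⟩
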